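/- Let $2\le k\le n-2$ and $[n]=\{1,\dots,n\}$. A point of the real Grassmannian $\mathrm{Gr}(r,n)$ is represented by a full rank $r\times n$ matrix $M$ (through its row span), with maximal minors $\Delta_I(M)$, $I\in\binom{[n]}{r}$. Let $\mathrm{Gr}_{\ge0}(r,n)$ be the set of points whose nonzero maximal minors all have the same sign, and $\mathrm{Gr}_{>0}(r,n)$ its subset where all maximal minors are nonzero. Let $\mathrm{alt}$ change the sign of every second column, and let $\perp$ denote orthogonal complements in $\mathbb R^n$. *Mandelstam variables.* For $2\times n$ matrices $\lambda,\tilde\lambda$ with columns $\lambda_1,\dots,\lambda_n$ and $\tilde\lambda_1,\dots,\tilde\lambda_n$, extended to $\mathbb Z$ by $\lambda_{m+n}=(-1)^{k-1}\lambda_m$, $\tilde\lambda_{m+n}=(-1)^{k-1}\tilde\lambda_m$, put $\langle p\,q\rangle=\det(\lambda_p,\lambda_q)$, $[p\,q]=\det(\tilde\lambda_p,\tilde\lambda_q)$. For $i,j\in\mathbb Z$ with $i+2\le j\le i+n-2$ put $$S_{i,j}(\lambda,\tilde\lambda)=\sum_{i<p<q\le j}\langle p\,q\rangle[p\,q],$$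 and let $I_{(i,j]}\subset[n]$ consist of the elements $i+1,\dots,j$ taken modulo $n$. *Immanants.* A $(k,n)$-partial non-crossing matching is a pair $(\tau,T)$, where $\tau$ is an involution of $[n]$ such that there are no $a<b<c<d$ with $\tau(a)=c$, $\tau(b)=d$, and $T\subset[n]$ is disjoint from $S(\tau)=\{l:\tau(l)\ne l\}$, with $2|T|+|S(\tau)|=2k$. Its arcs are the sets $\{l,\tau(l)\}$, $l\in S(\tau)$. It is compatible with $(A,B)$, $A,B\in\binom{[n]}k$, if $T=A\cap B$, $S(\tau)=(A\setminus B)\sqcup(B\setminus A)$ and $\tau(A\setminus B)=B\setminus A$. The Temperley–Lieb immanants $\Delta_{\tau,T}(C)$ of a $k\times n$ matrix $C$ are the numbers defined by $$\Delta_A(C)\Delta_B(C)=\sum_{(\tau,T)\text{ compatible with }(A,B)}\Delta_{\tau,T}(C)\qquad\text{for all }A,B\in\tbinom{[n]}k.$$ *Markings.* An arc is $I_{(i,j]}$-special if exactly one of its endpoints lies in $I_{(i,j]}$. A $(\tau,T,i,j)$-marking is a map $\mu:S(\tau)\to\{\mathrm L,\mathrm R,\mathrm J\}$ for which there are two distinct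 arcs $\{l_1,r_1\},\{l_2,r_2\}$ with $\mu(l_1)=\mu(l_2)=\mathrm J$, $\mu(r_1)=\mu(r_2)=\mathrm R$, $l_1,l_2\in I_{(i,j]}$, $r_1,r_2\notin I_{(i,j]}$, and such that every other arc has one endpoint marked $\mathrm L$ and the other one marked $\mathrm R$. Let $d_\mu$ be the number of $I_{(i,j]}$-special arcs of $\tau$ that lie strictly between $\{l_1,r_1\}$ and $\{l_2,r_2\}$, that is, which separate these two arcs when the arcs are drawn as disjoint chords of a disk with $1,\dots,n$ on its boundary circle. **Theorem.** Let $C\in\mathrm{Gr}_{\ge0}(k,n)$, $\Lambda\in\mathrm{alt}(\mathrm{Gr}_{>0}(n-k+2,n))$ and $\tilde\Lambda\in\mathrm{Gr}_{>0}(k+2,n)$, with matrices chosen to represent $C$, $\Lambda$, $\tilde\Lambda$ and $\Lambda^\perp\in\mathrm{Gr}(k-2,n)$. Put $$c^{(i,j]}_{\tau,T}(\Lambda,\tilde\Lambda)=\sum_{\mu\text{ a }(\tau,T,i,j)\text{-marking}}(-1)^{d_\mu}\,\Delta_{T\sqcup\mu^{-1}(\mathrm L)}(\Lambda^\perp)\,\Delta_{T\sqcup\mu^{-1}(\mathrm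 R)\sqcup\mu^{-1}(\mathrm J)}(\tilde\Lambda).$$ Then the immanants $\Delta_{\tau,T}(C)$ exist and are unique, and the subspaces $C\cap\Lambda$ and $C^\perp\cap\tilde\Lambda$, which make up $\Phi_{\Lambda,\tilde\Lambda}(C)$, are represented by $2\times n$ matrices $\lambda$ and $\tilde\lambda$, which can be chosen such that, for all $i,j\in\mathbb Z$ with $i+2\le j\le i+n-2$, $$S_{i,j}(\lambda,\tilde\lambda)=\sum_{(\tau,T)}c^{(i,j]}_{\tau,T}(\Lambda,\tilde\Lambda)\,\Delta_{\tau,T}(C),$$ where the sum is over all $(k,n)$-partial non-crossing matchings. For arbitrary $2\times n$ matrices $\lambda,\tilde\lambda$ representing these subspaces, the same identities hold up to a common factor: there is $\kappa\neq0$, independent of $i$ and $j$, with $S_{i,j}(\lambda,\tilde\lambda)=\kappa\sum_{(\tau,T)}c^{(i,j]}_{\tau,T}(\Lambda,\tilde\Lambda)\,\Delta_{\tau,T}(C)$ for all such $i,j$. Moreover, one can take $\kappa>0$ if the matrices representing $\Lambda^\perp$ and $\tilde\Lambda$ have nonnegative maximal minors, $\langle p\,p+1\rangle>0$ for some $p\in\mathbb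 Z$, and $[p\,p+1]>0$ for some $p\in\mathbb Z$. -/

import Mathlib

namespace TLMandelstam

/-! ### Points of the Grassmannian, minors, positivity

Points of `Gr(r, n)` are given by full rank `r × n` real matrices, through their row spans.
The column with index `a : Fin n` is the column labelled `a + 1 ∈ [n] = {1, …, n}`. -/

/-- The maximal minor `Δ_I(M)` of an `r × n` matrix, with the columns of `I` in increasing order.
It is only used for `|I| = r` (and set to `0` for other `I`). -/
noncomputable def plucker {r n : ℕ} (M : Matrix (Fin r) (Fin n) ℝ) (I : Finset (Fin n)) : ℝ :=
  if h : I.card = r then (M.submatrix id (I.orderEmbOfFin h)).det else 0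

/-- The row span of a matrix. -/
def rowSpan {r n : ℕ} (M : Matrix (Fin r) (Fin n) ℝ) : Submodule ℝ (Fin n → ℝ) :=
  Submodule.span ℝ (Set.range M.row)

/-- The orthogonal complement in `ℝⁿ` for the standard dot product. -/
def perp {n : ℕ} (W : Submodule ℝ (Fin n → ℝ)) : Submodule ℝ (Fin n → ℝ) where
  carrier := {v | ∀ w ∈ W, v ⬝ᵥ w = 0}
  add_mem' := by
    intro a b ha hb w hw
    simp [add_dotProduct, ha w hw, hb w hw]
  zero_mem' := by
    intro w _
    simp
  smul_mem' := by
    intro c a ha w hw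
    simp [smul_dotProduct, ha w hw]

/-- The rows of `M` form a basis of the subspace `W`, so that `W ∈ Gr(r, n)` is represented by the
matrix `M`. -/
def Represents {r n : ℕ} (M : Matrix (Fin r) (Fin n) ℝ) (W : Submodule ℝ (Fin n → ℝ)) : Prop :=
  LinearIndependent ℝ M.row ∧ rowSpan M = W

/-- `M` represents a point of the totally nonnegative Grassmannian: it has full rank and all its
nonzero maximal minors have the same sign. -/
def IsTotallyNonneg {r n : ℕ} (M : Matrix (Fin r) (Fin n) ℝ) : Prop :=
  LinearIndependent ℝ M.row ∧
    ∀ I J : Finset (Fin n), I.card = r → J.card = r → 0 ≤ plucker M I * plucker M J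

/-- `M` represents a point of the totally positive Grassmannian. -/
def IsTotallyPos {r n : ℕ} (M : Matrix (Fin r) (Fin n) ℝ) : Prop :=
  IsTotallyNonneg M ∧ ∀ I : Finset (Fin n), I.card = r → plucker M I ≠ 0

/-- The map `alt`, changing the sign of every second column:
`(C₁, C₂, C₃, …) ↦ (C₁, -C₂, C₃, …)`. -/
def alt {r n : ℕ} (M : Matrix (Fin r) (Fin n) ℝ) : Matrix (Fin r) (Fin n) ℝ :=
  Matrix.of fun s a => (-1) ^ (a : ℕ) * M s a

/-- The momentum amplituhedron map `C ↦ (C ∩ Λ, C^⊥ ∩ Λ̃)`. -/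
def momentumMap {n : ℕ} (La Lat C : Submodule ℝ (Fin n → ℝ)) :
    Submodule ℝ (Fin n → ℝ) × Submodule ℝ (Fin n → ℝ) :=
  (C ⊓ La, perp C ⊓ Lat)

/-! ### Planar Mandelstam variables -/

/-- The columns `(λ_m)_{m ∈ ℤ}` of a `2 × n` matrix, extended from `m ∈ {1, …, n}` to all of `ℤ`
by the twisted cyclic symmetry `λ_{m+n} = (-1)^{k-1} λ_m`. -/
noncomputable def extCol (k : ℕ) {n : ℕ} (hn : 0 < n) (M : Matrix (Fin 2) (Fin n) ℝ) (m : ℤ) :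
    Fin 2 → ℝ :=
  fun s => (-1 : ℝ) ^ (((k : ℤ) - 1) * ((m - 1) / (n : ℤ))) *
    M s ⟨((m - 1) % (n : ℤ)).toNat, by
      have h1 := Int.emod_nonneg (m - 1) (b := (n : ℤ)) (by omega)
      have h2 := Int.emod_lt_of_pos (m - 1) (b := (n : ℤ)) (by omega)
      omega⟩

/-- The bracket `⟨p q⟩ = det(λ_p, λ_q)`, for `p, q ∈ ℤ`. -/
noncomputable def bracket (k : ℕ) {n : ℕ} (hn : 0 < n) (M : Matrix (Fin 2) (Fin n) ℝ)
    (p q : ℤ) : ℝ :=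
  extCol k hn M p 0 * extCol k hn M q 1 - extCol k hn M q 0 * extCol k hn M p 1

/-- The planar Mandelstam variable `∑_{i < p < q ≤ j} ⟨p q⟩ [p q]`. -/
noncomputable def mandelstam (k : ℕ) {n : ℕ} (hn : 0 < n) (la lat : Matrix (Fin 2) (Fin n) ℝ)
    (i j : ℤ) : ℝ :=
  ∑ p ∈ Finset.Ioc i j, ∑ q ∈ Finset.Ioc p j, bracket k hn la p q * bracket k hn lat p q

/-! ### Temperley–Lieb immanants -/

/-- The `(k, n)`-partial non-crossing matchings `(τ, T)`. -/
@[ext]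
structure PartialMatching (k n : ℕ) where
  /-- the involution `τ` of `[n]` -/
  τ : Fin n → Fin n
  /-- the set `T` -/
  T : Finset (Fin n)
  involutive : ∀ l, τ (τ l) = l
  noncrossing : ¬ ∃ a b c d : Fin n, a < b ∧ b < c ∧ c < d ∧ τ a = c ∧ τ b = d
  disjoint : ∀ l ∈ T, τ l = l
  card_eq : 2 * T.card + (Finset.univ.filter fun l => τ l ≠ l).card = 2 * k

noncomputable instance (k n : ℕ) : Fintype (PartialMatching k n) :=
  Fintype.ofInjective (fun x => (x.τ, x.T)) fun x y h => by
    rw [Prod.mk.injEq] at h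
    exact PartialMatching.ext h.1 h.2

/-- The set `S(τ)` of the matched elements of `[n]`. -/
def PartialMatching.S {k n : ℕ} (x : PartialMatching k n) : Finset (Fin n) :=
  Finset.univ.filter fun l => x.τ l ≠ l

/-- `(τ, T)` is compatible with `(A, B)`. -/
def PartialMatching.Compatible {k n : ℕ} (x : PartialMatching k n) (A B : Finset (Fin n)) : Prop :=
  x.T = A ∩ B ∧ x.S = (A \ B) ∪ (B \ A) ∧ (A \ B).image x.τ = B \ A

open Classical in
/-- The relations that define the values at `C` of the Temperley–Lieb immanants:
`Δ_A(C) Δ_B(C) = ∑ F(τ, T)` over all `(τ, T)` compatible with `(A, B)`, for all `k`-subsets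
`A, B` of `[n]`. -/
def IsTLFamily {k n : ℕ} (C : Matrix (Fin k) (Fin n) ℝ) (F : PartialMatching k n → ℝ) : Prop :=
  ∀ A B : Finset (Fin n), A.card = k → B.card = k →
    plucker C A * plucker C B = ∑ x : PartialMatching k n with x.Compatible A B, F x

/-- The Temperley–Lieb immanants `Δ_{τ,T}(C)`: the family that satisfies the defining relations.
(That exactly one such family exists is part of the main statement.) -/
noncomputable def tlImmanant {k n : ℕ} (C : Matrix (Fin k) (Fin n) ℝ) :
    PartialMatching k n → ℝ :=
  Classical.epsilon (IsTLFamily C)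

/-! ### Markings and coefficients -/

/-- The set `I_{(i,j]} ⊆ [n]` of the elements of `{i+1, …, j}` modulo `n`. -/
def InInterval {n : ℕ} (i j : ℤ) (a : Fin n) : Prop :=
  ∃ m : ℤ, i < m ∧ m ≤ j ∧ m ≡ (a : ℤ) + 1 [ZMOD n]

/-- The three labels. -/
inductive Mark
  | L
  | R
  | J
  deriving DecidableEq

instance : Fintype Mark where
  elems := {Mark.L, Mark.R, Mark.J}
  complete c := by cases c <;> simp

/-- The other endpoint of the arc of `τ` through `l ∈ S(τ)`. -/
def PartialMatching.mate {k n : ℕ} (x : PartialMatching k n) (l : {l : Fin n // l ∈ x.S}) :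
    {l : Fin n // l ∈ x.S} :=
  ⟨x.τ l, by
    have h := l.2
    simp only [PartialMatching.S, Finset.mem_filter, Finset.mem_univ, true_and] at h ⊢
    rw [x.involutive]
    exact fun e => h e.symm⟩

/-- `μ : S(τ) → {L, R, J}` is a `(τ, T, i, j)`-marking. -/
def IsMarking {k n : ℕ} (x : PartialMatching k n) (i j : ℤ)
    (μ : {l : Fin n // l ∈ x.S} → Mark) : Prop :=
  ∃ l₁ l₂ : {l : Fin n // l ∈ x.S}, l₁ ≠ l₂ ∧
    (μ l₁ = Mark.J ∧ InInterval i j l₁.1 ∧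
      μ (x.mate l₁) = Mark.R ∧ ¬ InInterval i j (x.mate l₁).1) ∧
    (μ l₂ = Mark.J ∧ InInterval i j l₂.1 ∧
      μ (x.mate l₂) = Mark.R ∧ ¬ InInterval i j (x.mate l₂).1) ∧
    ∀ l, l ≠ l₁ → l ≠ x.mate l₁ → l ≠ l₂ → l ≠ x.mate l₂ →
      (μ l = Mark.L ∧ μ (x.mate l) = Mark.R) ∨ (μ l = Mark.R ∧ μ (x.mate l) = Mark.L)

open Classical in
/-- The preimage `μ⁻¹(c)`, as a subset of `[n]`. -/
noncomputable def fiber {k n : ℕ} (x : PartialMatching k n)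
    (μ : {l : Fin n // l ∈ x.S} → Mark) (c : Mark) : Finset (Fin n) :=
  Finset.univ.filter fun l => ∃ h : l ∈ x.S, μ ⟨l, h⟩ = c

/-- For distinct arcs of a non-crossing matching, drawn as disjoint chords of a disk with the points
`1, …, n` on its boundary circle: the chord `{a, b}`, `a < b`, has the chord `{l₁, r₁}` on its side
between `a` and `b`, and the chord `{l₂, r₂}` on its other side. -/
def Separates {n : ℕ} (a b l₁ r₁ l₂ r₂ : Fin n) : Prop :=
  (a < l₁ ∧ l₁ < b) ∧ (a < r₁ ∧ r₁ < b) ∧ (l₂ < a ∨ b < l₂) ∧ (r₂ < a ∨ b < r₂)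

open Classical in
/-- The number `d_μ` of the `I_{(i,j]}`-special arcs `{a, τ(a)}` (those with exactly one endpoint in
`I_{(i,j]}`) that lie strictly between the two arcs of `τ` with an endpoint marked by `J`. Each
arc is counted through its smaller endpoint `a`. -/
noncomputable def dStat {k n : ℕ} (x : PartialMatching k n) (i j : ℤ)
    (μ : {l : Fin n // l ∈ x.S} → Mark) : ℕ :=
  (Finset.univ.filter fun a : Fin n => a < x.τ a ∧
    Xor (InInterval i j a) (InInterval i j (x.τ a)) ∧
    ∃ l₁ ∈ fiber x μ Mark.J, ∃ l₂ ∈ fiber x μ Mark.J,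
      Separates a (x.τ a) l₁ (x.τ l₁) l₂ (x.τ l₂)).card

open Classical in
/-- The coefficient of the immanant of `(τ, T)`: the sum over all `(τ, T, i, j)`-markings `μ` of
`(-1)^{d_μ} Δ_{T ⊔ μ⁻¹(L)}(Λ^⊥) Δ_{T ⊔ μ⁻¹(R) ⊔ μ⁻¹(J)}(Λ̃)`. Here `Lp` represents `Λ^⊥`. -/
noncomputable def coeff {k n : ℕ} (i j : ℤ) (x : PartialMatching k n)
    (Lp : Matrix (Fin (k - 2)) (Fin n) ℝ) (Lat : Matrix (Fin (k + 2)) (Fin n) ℝ) : ℝ :=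
  ∑ μ : {l : Fin n // l ∈ x.S} → Mark with IsMarking x i j μ,
    (-1 : ℝ) ^ dStat x i j μ *
      plucker Lp (x.T ∪ fiber x μ Mark.L) *
      plucker Lat (x.T ∪ fiber x μ Mark.R ∪ fiber x μ Mark.J)

end TLMandelstam

/-!
The subspace `C ∩ Λ` consists of the vectors of the row span of `C` that are orthogonal to `Λ^⊥`,
and `C^⊥ ∩ Λ̃` of those of the row span of `Λ̃` that are orthogonal to `C`. For both, the `2 × 2`
minors of a representing matrix are, up to one factor, the determinants `det (M_p, M_q, M Wᵀ)`
(`contraction`; `exists_minor2_eq_mul_contraction`, by Cramer's rule), with `(M, W) = (C, Λ^⊥)` and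
`(M, W) = (Λ̃, C)`. By Cauchy–Binet (`contraction_eq_sum`) these are signed sums of products of
Plücker coordinates, and in `⟨p q⟩ [p q]` the coordinates of `C` occur in pairs
`Δ_{A ∪ {p, q}}(C) Δ_B(C)`, which are expanded into immanants. Up to sign, each immanant then has as
coefficient a sum over transversals `U` of the matching with two distinguished elements `p`, `q` of
the interval (`contraction_mul_contraction_eq_sum`). The sign depends only on the parity of the
number of matched elements between `p` and `q`; it changes when `p` or `q` is moved to the other end
of its arc, as non-crossing arcs enclose evenly many matched elements (`posSign_τ`). Hence all
contributions cancel in which one of the two arcs has both ends in the interval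
(`sum_pointed_eq`), and the others are the markings (`coeff_eq_sum_term`). In these, the sign counts
the special arcs between the two distinguished ones (`neg_posSign_mul_posSign`).

The immanants exist and are unique (`existsUnique_isTLFamily`) by a triangularity argument. The
relations for the pairs built from the left and the right endpoints of the matchings form a
unitriangular system for the family, with respect to the sum of the left endpoints
(`sum_left_lt`). The remaining relations follow by straightening (`eq_zero_of_ballot`): products of
two minors and indicator functions of transversals satisfy the same signed one-column exchange
relations, and these reduce everything to ballot pairs, which come from matchings
(`exists_noncrossing`).

The intersections have dimension two because some `det (M_p, M_q, M Wᵀ)` is non-zero: for suitable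
`p` and `q`, all terms of its expansion have the same sign (`contraction_ne_zero`). This uses that
`Λ^⊥` is totally positive, by the duality of complementary minors
(`exists_plucker_eq_mul_plucker_alt_compl`). For cyclically adjacent `p` and `q` all terms have the
same sign as well, which gives the sign of the common factor.
-/

namespace TLMandelstam

open Finset Matrix

variable {n r : ℕ}

/-! ### Minors with columns in arbitrary order, and the Cauchy–Binet expansion -/

/-- The sign of `b - a`, as a real number. -/
noncomputable def ordSign {n : ℕ} (a b : Fin n) : ℝ :=
  if a < b then 1 else if b < a then -1 else 0


theorem ordSign_of_lt {a b : Fin n} (h : a < b) : ordSign a b = 1 := by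
  simp [ordSign, h]

theorem ordSign_of_gt {a b : Fin n} (h : b < a) : ordSign a b = -1 := by
  simp [ordSign, h, h.le]

@[simp] theorem ordSign_self (a : Fin n) : ordSign a a = 0 := by
  simp [ordSign]

theorem ordSign_swap (a b : Fin n) : ordSign a b = -ordSign b a := by
  rcases lt_trichotomy a b with h | rfl | h
  · rw [ordSign_of_lt h, ordSign_of_gt h]; norm_num
  · rw [ordSign_self, neg_zero]
  · rw [ordSign_of_lt h, ordSign_of_gt h]

theorem ordSign_mul_self {a b : Fin n} (h : a ≠ b) : ordSign a b * ordSign a b = 1 := by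
  rcases lt_or_gt_of_ne h with h | h
  · simp [ordSign_of_lt h]
  · rw [ordSign_of_gt h]; norm_num

theorem prod_orderEmbOfFin {A : Finset (Fin n)} (hA : A.card = r) (f : Fin n → ℝ) :
    ∏ i, f (A.orderEmbOfFin hA i) = ∏ a ∈ A, f a := by
  conv_rhs => rw [← image_orderEmbOfFin_univ A hA]
  rw [prod_image fun x _ y _ h => (A.orderEmbOfFin hA).injective h]

/-- The parity of the number of elements of `S` below `a`, as a sign. -/
noncomputable def posSign (S : Finset (Fin n)) (a : Fin n) : ℝ :=
  ∏ s ∈ S.erase a, ordSign a s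

theorem posSign_mul_self (S : Finset (Fin n)) (a : Fin n) : posSign S a * posSign S a = 1 := by
  rw [posSign, ← prod_mul_distrib]
  exact prod_eq_one fun s hs => ordSign_mul_self (ne_of_mem_erase hs).symm

theorem posSign_ne_zero (S : Finset (Fin n)) (a : Fin n) : posSign S a ≠ 0 := by
  intro h0
  have := posSign_mul_self S a
  rw [h0] at this
  norm_num at this

theorem posSign_univ (a : Fin n) : posSign univ a = (-1) ^ (a : ℕ) := by
  have : ∀ j ∈ univ.erase a, ordSign a j = if j < a then -1 else 1 := by
    intro j hj
    split_ifs with hji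
    · exact ordSign_of_gt hji
    · exact ordSign_of_lt (lt_of_le_of_ne (not_lt.1 hji) (ne_of_mem_erase hj).symm)
  rw [posSign, prod_congr rfl this, prod_ite]
  simp only [prod_const, one_pow, mul_one]
  congr 1
  have : filter (fun j => j < a) (univ.erase a) = Iio a := by
    ext j
    simp only [mem_filter, mem_erase, mem_univ, and_true, mem_Iio, and_iff_right_iff_imp]
    exact fun h => h.ne
  rw [this, Fin.card_Iio]

theorem posSign_orderEmbOfFin {A : Finset (Fin n)} (hA : A.card = r) (i : Fin r) :
    posSign A (A.orderEmbOfFin hA i) = (-1) ^ (i : ℕ) := by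
  have h : A.erase (A.orderEmbOfFin hA i) = (univ.erase i).image (A.orderEmbOfFin hA) := by
    rw [image_erase (A.orderEmbOfFin hA).injective, image_orderEmbOfFin_univ]
  rw [← posSign_univ, posSign, h, prod_image fun x _ y _ h => (A.orderEmbOfFin hA).injective h,
    posSign]
  refine prod_congr rfl fun j _ => ?_
  simp only [ordSign, OrderEmbedding.lt_iff_lt]

theorem det_submatrix_eq_sign_mul_plucker (M : Matrix (Fin r) (Fin n) ℝ) {g : Fin r → Fin n}
    (hg : Function.Injective g) :
    (M.submatrix id g).det =
      (∏ i, ∏ j ∈ Ioi i, ordSign (g i) (g j)) * plucker M (univ.image g) := by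
  have hc : (univ.image g).card = r := by
    rw [card_image_of_injective _ hg, card_univ, Fintype.card_fin]
  set e := (univ.image g).orderEmbOfFin hc with he
  have hmem : ∀ i, ∃ j, e j = g i := by
    intro i
    have : g i ∈ Set.range e := by
      rw [he, range_orderEmbOfFin]
      simp
    exact this
  choose s hs using hmem
  have hsi : Function.Injective s := by
    intro i j hij
    apply hg
    rw [← hs i, ← hs j, hij]
  let σ : Equiv.Perm (Fin r) := Equiv.ofBijective s (Finite.injective_iff_bijective.1 hsi)
  have hgσ : g = fun i => e (σ i) := by
    funext i
    exact (hs i).symm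
  have h1 : (∏ i, ∏ j ∈ Ioi i, ordSign (g i) (g j)) = (Equiv.Perm.sign σ : ℤ) := by
    rw [hgσ]
    have := σ.prod_Ioi_comp_eq_sign_mul_prod (R := ℝ) (f := fun i j => ordSign (e i) (e j))
      (fun i j => ordSign_swap _ _)
    rw [this, prod_eq_one, mul_one]
    intro i _
    refine prod_eq_one fun j hj => ordSign_of_lt ?_
    exact e.strictMono (mem_Ioi.1 hj)
  rw [h1, plucker, dif_pos hc, ← he, ← Matrix.det_permute' σ]
  rw [Matrix.submatrix_submatrix, hgσ]
  rfl

theorem plucker_eq_zero_of_card {M : Matrix (Fin r) (Fin n) ℝ} {I : Finset (Fin n)}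
    (h : I.card ≠ r) : plucker M I = 0 := by
  simp [plucker, h]

/-- Cauchy–Binet for an alternating form evaluated on `r` combinations of `n` vectors. -/
theorem alternatingMap_sum_eq {E : Type*} [AddCommGroup E] [Module ℝ E]
    (φ : E [⋀^Fin r]→ₗ[ℝ] ℝ) (v : Fin n → E) (W : Matrix (Fin r) (Fin n) ℝ)
    (ψ : Finset (Fin n) → ℝ)
    (hψ : ∀ (A : Finset (Fin n)) (h : A.card = r), φ (fun i => v (A.orderEmbOfFin h i)) = ψ A) :
    φ (fun i => ∑ a, W i a • v a) = ∑ A, plucker W A * ψ A := by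
  have h0 : φ (fun i => ∑ a, W i a • v a)
      = ∑ f : Fin r → Fin n, (∏ i, W i (f i)) * φ (fun i => v (f i)) := by
    have := φ.toMultilinearMap.map_sum (fun i a => W i a • v a)
    simp only [AlternatingMap.coe_multilinearMap] at this
    rw [this]
    refine sum_congr rfl fun f _ => ?_
    have := φ.toMultilinearMap.map_smul_univ (fun i => W i (f i)) (fun i => v (f i))
    simpa using this
  rw [h0, ← sum_fiberwise (s := univ) (g := fun f : Fin r → Fin n => univ.image f)]
  refine sum_congr rfl fun A _ => ?_
  by_cases hA : A.card = r
  · rw [← hψ A hA, plucker, dif_pos hA, Matrix.det_apply', sum_mul]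
    symm
    refine sum_bij (fun (σ : Equiv.Perm (Fin r)) _ i => A.orderEmbOfFin hA (σ⁻¹ i)) ?_ ?_ ?_ ?_
    · intro σ _
      simp only [mem_filter, mem_univ, true_and]
      ext a
      simp only [mem_image, mem_univ, true_and]
      constructor
      · rintro ⟨i, rfl⟩
        exact orderEmbOfFin_mem _ _ _
      · intro ha
        have : a ∈ Set.range (A.orderEmbOfFin hA) := by
          rw [range_orderEmbOfFin]; exact ha
        obtain ⟨j, rfl⟩ := this
        exact ⟨σ j, by simp⟩
    · intro σ _ σ' _ h
      have : σ⁻¹ = σ'⁻¹ := by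
        ext i
        have := congrFun h i
        simpa [Fin.ext_iff] using this
      exact inv_injective this
    · intro f hf
      simp only [mem_filter, mem_univ, true_and] at hf
      have hmem : ∀ i, ∃ j, A.orderEmbOfFin hA j = f i := by
        intro i
        have : f i ∈ Set.range (A.orderEmbOfFin hA) := by
          rw [range_orderEmbOfFin, ← hf]
          simp
        exact this
      choose s hs using hmem
      have hfi : Function.Injective f := by
        have : Set.InjOn f (univ : Finset (Fin r)) := by
          rw [← card_image_iff, hf, hA, card_univ, Fintype.card_fin]
        intro a b hab
        exact this (by simp) (by simp) hab
      have hsi : Function.Injective s := by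
        intro a b hab
        apply hfi
        rw [← hs a, ← hs b, hab]
      let σ : Equiv.Perm (Fin r) := Equiv.ofBijective s (Finite.injective_iff_bijective.1 hsi)
      refine ⟨σ⁻¹, mem_univ _, ?_⟩
      funext i
      rw [inv_inv]
      exact hs i
    · intro σ _
      have h1 := φ.map_perm (fun i => v (A.orderEmbOfFin hA i)) σ⁻¹
      have h2 : (fun i => v (A.orderEmbOfFin hA i)) ∘ (σ⁻¹ : Equiv.Perm (Fin r)) =
        fun i => v (A.orderEmbOfFin hA (σ⁻¹ i)) := rfl
      have h3 : ∏ i, W i (A.orderEmbOfFin hA (σ⁻¹ i)) =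
          ∏ i, (W.submatrix id (A.orderEmbOfFin hA)) (σ i) i := by
        rw [← Equiv.prod_comp σ]
        simp
      rw [← h2, h1, h3, Equiv.Perm.sign_inv, Units.smul_def, zsmul_eq_mul]
      ring
  · rw [plucker_eq_zero_of_card hA, zero_mul]
    refine sum_eq_zero fun f hf => ?_
    simp only [mem_filter, mem_univ, true_and] at hf
    rw [φ.map_eq_zero_of_not_injective, mul_zero]
    intro hi
    apply hA
    rw [← hf, card_image_of_injective univ (f := f), card_univ, Fintype.card_fin]
    intro a b hab
    exact hi (by simp [hab])


theorem det_vecCons_columns {M : Matrix (Fin (r + 1)) (Fin n) ℝ} (a : Fin n) {B : Finset (Fin n)}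
    (hB : B.card = r) :
    (Matrix.of (vecCons (Mᵀ a) fun i => Mᵀ (B.orderEmbOfFin hB i))).det =
      (∏ b ∈ B, ordSign a b) * plucker M (insert a B) := by
  have h0 : Matrix.of (vecCons (Mᵀ a) fun i => Mᵀ (B.orderEmbOfFin hB i)) =
      (M.submatrix id (vecCons a (B.orderEmbOfFin hB)))ᵀ := by
    ext i j
    refine Fin.cases ?_ (fun i => ?_) i <;> rfl
  by_cases ha : a ∈ B
  · rw [prod_eq_zero ha (ordSign_self a), zero_mul]
    have : a ∈ Set.range (B.orderEmbOfFin hB) := by rw [range_orderEmbOfFin]; exact ha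
    obtain ⟨i, hi⟩ := this
    refine Matrix.det_zero_of_row_eq (i := 0) (j := i.succ) (Fin.succ_ne_zero i).symm ?_
    funext j
    change M j a = M j (B.orderEmbOfFin hB i)
    rw [hi]
  · have hinj : Function.Injective (vecCons a (B.orderEmbOfFin hB)) := by
      rw [Matrix.vecCons, Fin.cons_injective_iff, range_orderEmbOfFin]
      exact ⟨by simpa using ha, (B.orderEmbOfFin hB).injective⟩
    have himg : univ.image (vecCons a (B.orderEmbOfFin hB)) = insert a B := by
      apply Finset.coe_injective
      rw [coe_image, coe_univ, Set.image_univ, Matrix.range_cons, range_orderEmbOfFin, coe_insert]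
      rfl
    rw [h0, det_transpose, det_submatrix_eq_sign_mul_plucker M hinj, himg, Fin.prod_univ_succ,
      Fin.prod_Ioi_zero,
      ← prod_orderEmbOfFin hB]
    congr 1
    simp only [Fin.prod_Ioi_succ]
    have : ∏ i, ∏ j ∈ Ioi i, ordSign (B.orderEmbOfFin hB i) (B.orderEmbOfFin hB j) = 1 := by
      refine prod_eq_one fun i _ => prod_eq_one fun j hj => ordSign_of_lt ?_
      exact (B.orderEmbOfFin hB).strictMono (mem_Ioi.1 hj)
    exact (congrArg _ this).trans (mul_one _)

theorem det_vecCons_vecCons_columns {M : Matrix (Fin (r + 2)) (Fin n) ℝ} (p q : Fin n)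
    {A : Finset (Fin n)} (hA : A.card = r) :
    (Matrix.of (vecCons (Mᵀ p) (vecCons (Mᵀ q) fun i => Mᵀ (A.orderEmbOfFin hA i)))).det =
      ordSign p q * (∏ a ∈ A, ordSign p a * ordSign q a) * plucker M (insert p (insert q A)) := by
  have h0 : Matrix.of (vecCons (Mᵀ p) (vecCons (Mᵀ q) fun i => Mᵀ (A.orderEmbOfFin hA i))) =
      (M.submatrix id (vecCons p (vecCons q (A.orderEmbOfFin hA))))ᵀ := by
    ext i j
    refine Fin.cases ?_ (fun i => ?_) i
    · rfl
    · refine Fin.cases ?_ (fun i => ?_) i <;> rfl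
  by_cases hinj : Function.Injective (vecCons p (vecCons q (A.orderEmbOfFin hA)))
  · have himg : univ.image (vecCons p (vecCons q (A.orderEmbOfFin hA))) =
        insert p (insert q A) := by
      apply Finset.coe_injective
      rw [coe_image, coe_univ, Set.image_univ, Matrix.range_cons, Matrix.range_cons,
        range_orderEmbOfFin, coe_insert, coe_insert]
      rfl
    rw [h0, det_transpose, det_submatrix_eq_sign_mul_plucker M hinj, himg, Fin.prod_univ_succ,
      Fin.prod_univ_succ, Fin.prod_Ioi_zero, Fin.prod_Ioi_succ, Fin.prod_Ioi_zero,
      Fin.prod_univ_succ, ← prod_orderEmbOfFin hA, prod_mul_distrib]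
    simp only [Fin.prod_Ioi_succ]
    have : ∏ i, ∏ j ∈ Ioi i, ordSign (A.orderEmbOfFin hA i) (A.orderEmbOfFin hA j) = 1 := by
      refine prod_eq_one fun i _ => prod_eq_one fun j hj => ordSign_of_lt ?_
      exact (A.orderEmbOfFin hA).strictMono (mem_Ioi.1 hj)
    change ordSign p q * (∏ i, ordSign p (A.orderEmbOfFin hA i)) *
      ((∏ i, ordSign q (A.orderEmbOfFin hA i)) *
        ∏ i, ∏ j ∈ Ioi i, ordSign (A.orderEmbOfFin hA i) (A.orderEmbOfFin hA j)) * _ = _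
    rw [this]
    ring
  · have h1 : ordSign p q * (∏ a ∈ A, ordSign p a * ordSign q a) = 0 := by
      by_contra hne
      apply hinj
      have hpq : p ≠ q := by
        rintro rfl
        simp at hne
      have hp : p ∉ A := fun h => hne (by rw [prod_eq_zero h (by simp), mul_zero])
      have hq : q ∉ A := fun h => hne (by rw [prod_eq_zero h (by simp), mul_zero])
      rw [Matrix.vecCons, Fin.cons_injective_iff, Matrix.vecCons, Fin.cons_injective_iff,
        range_orderEmbOfFin, ← Matrix.vecCons, Matrix.range_cons, range_orderEmbOfFin]
      exact ⟨by simp [hpq, hp], by simpa using hq, (A.orderEmbOfFin hA).injective⟩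
    rw [h1, zero_mul]
    have : ∃ i j, i ≠ j ∧ vecCons p (vecCons q (A.orderEmbOfFin hA)) i =
        vecCons p (vecCons q (A.orderEmbOfFin hA)) j := by
      simp only [Function.Injective] at hinj
      push Not at hinj
      obtain ⟨i, j, h, hij⟩ := hinj
      exact ⟨i, j, hij, h⟩
    obtain ⟨i, j, hij, h⟩ := this
    rw [h0]
    refine Matrix.det_zero_of_row_eq hij ?_
    funext s
    simp only [transpose_apply, submatrix_apply, h]

/-- The determinant `det (M_p, M_q, M Wᵀ)` of two columns of `M` together with the columns of
`M Wᵀ`. Up to a constant factor, these are the `2 × 2` minors of a matrix that represents the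
intersection of the row span of `M` with the orthogonal complement of the row span of `W`. -/
noncomputable def contraction (M : Matrix (Fin (r + 2)) (Fin n) ℝ) (W : Matrix (Fin r) (Fin n) ℝ)
    (p q : Fin n) : ℝ :=
  (Matrix.of (vecCons (Mᵀ p) (vecCons (Mᵀ q) (W * Mᵀ)))).det

theorem contraction_eq_sum (M : Matrix (Fin (r + 2)) (Fin n) ℝ) (W : Matrix (Fin r) (Fin n) ℝ)
    (p q : Fin n) :
    contraction M W p q = ∑ A, plucker W A *
      (ordSign p q * (∏ a ∈ A, ordSign p a * ordSign q a) * plucker M (insert p (insert q A))) := by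
  have := alternatingMap_sum_eq
    (((Matrix.detRowAlternating (n := Fin (r + 2)) (R := ℝ)).curryLeft (Mᵀ p)).curryLeft (Mᵀ q))
    Mᵀ W (fun A => ordSign p q * (∏ a ∈ A, ordSign p a * ordSign q a) *
      plucker M (insert p (insert q A)))
    (fun A hA => by rw [← det_vecCons_vecCons_columns p q hA]; rfl)
  rw [← this]
  have h : (fun i => ∑ a, W i a • Mᵀ a) = W * Mᵀ := by
    funext i s
    simp [Matrix.mul_apply]
  rw [h]
  rfl

theorem det_mul_transpose_self (M : Matrix (Fin r) (Fin n) ℝ) :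
    (M * Mᵀ).det = ∑ A, plucker M A ^ 2 := by
  have := alternatingMap_sum_eq (Matrix.detRowAlternating (n := Fin r) (R := ℝ)) Mᵀ M
    (fun A => plucker M A) (fun A hA => by
      rw [plucker, dif_pos hA, ← det_transpose]; rfl)
  have h : (fun i => ∑ a, M i a • Mᵀ a) = M * Mᵀ := by
    funext i s
    simp [Matrix.mul_apply]
  rw [h] at this
  simp only [sq]
  exact this

/-- The linear relation between `r + 2` columns of a matrix with `r + 1` rows, from expanding a
determinant with a repeated row. -/
theorem sum_plucker_erase_smul (M : Matrix (Fin (r + 1)) (Fin n) ℝ) {A : Finset (Fin n)}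
    (hA : A.card = r + 2) :
    ∑ a ∈ A, (posSign A a * plucker M (A.erase a)) • Mᵀ a = 0 := by
  funext s
  have hdet : (Matrix.of (vecCons (M s) M) |>.submatrix id (A.orderEmbOfFin hA)).det = 0 := by
    refine Matrix.det_zero_of_row_eq (i := 0) (j := s.succ) (Fin.succ_ne_zero s).symm ?_
    rfl
  rw [det_succ_row_zero] at hdet
  rw [Finset.sum_apply, Pi.zero_apply, ← hdet]
  have himg := image_orderEmbOfFin_univ A hA
  have hinj := (A.orderEmbOfFin hA).injective
  conv_lhs => rw [← himg, sum_image fun x _ y _ h => hinj h]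
  refine sum_congr rfl fun i _ => ?_
  rw [himg]
  have h3 : plucker M (A.erase (A.orderEmbOfFin hA i)) =
      (M.submatrix id (fun j => A.orderEmbOfFin hA (i.succAbove j))).det := by
    have hc : (A.erase (A.orderEmbOfFin hA i)).card = r + 1 := by
      rw [card_erase_of_mem (orderEmbOfFin_mem _ _ _), hA]
      rfl
    rw [plucker, dif_pos hc]
    congr 2
    symm
    apply orderEmbOfFin_unique hc
    · intro j
      rw [mem_erase]
      exact ⟨fun h => Fin.succAbove_ne i j (hinj h), orderEmbOfFin_mem _ _ _⟩
    · exact (A.orderEmbOfFin hA).strictMono.comp (Fin.strictMono_succAbove i)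
  rw [posSign_orderEmbOfFin, h3]
  change _ * M s (A.orderEmbOfFin hA i) = (-1) ^ (i : ℕ) * M s (A.orderEmbOfFin hA i) *
    (M.submatrix id (fun j => A.orderEmbOfFin hA (i.succAbove j))).det
  ring

/-- The Plücker relations that exchange one column. -/
theorem plucker_relation (M : Matrix (Fin (r + 1)) (Fin n) ℝ) {A B : Finset (Fin n)}
    (hA : A.card = r + 2) (hB : B.card = r) :
    ∑ a ∈ A, (posSign A a * ∏ b ∈ B, ordSign a b) *
      (plucker M (A.erase a) * plucker M (insert a B)) = 0 := by
  let φ : (Fin (r + 1) → ℝ) →ₗ[ℝ] ℝ :=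
    { toFun := fun v => (Matrix.detRowAlternating (n := Fin (r + 1)) (R := ℝ)).curryLeft v
        (fun i => Mᵀ (B.orderEmbOfFin hB i))
      map_add' := by intro v w; simp only [map_add, AlternatingMap.add_apply]
      map_smul' := by intro c v; simp only [map_smul, AlternatingMap.smul_apply, RingHom.id_apply] }
  have hφ : ∀ a, φ (Mᵀ a) = (∏ b ∈ B, ordSign a b) * plucker M (insert a B) := fun a =>
    det_vecCons_columns a hB
  have := congrArg φ (sum_plucker_erase_smul M hA)
  rw [map_sum, map_zero] at this
  rw [← this]
  refine sum_congr rfl fun a _ => ?_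
  rw [map_smul, hφ, smul_eq_mul]
  ring

/-! ### Parity in non-crossing matchings -/

theorem prod_ordSign_mul_ordSign {S : Finset (Fin n)} {p q : Fin n} (hp : p ∈ S) (hq : q ∈ S)
    (hpq : p ≠ q) :
    ∏ s ∈ (S.erase p).erase q, ordSign p s * ordSign q s = -(posSign S p * posSign S q) := by
  rw [posSign, posSign, ← mul_prod_erase (S.erase p) _ (mem_erase.2 ⟨hpq.symm, hq⟩),
    ← mul_prod_erase (S.erase q) _ (mem_erase.2 ⟨hpq, hp⟩), erase_right_comm (a := q),
    prod_mul_distrib, ordSign_swap q p]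
  have := ordSign_mul_self hpq
  linear_combination (-(∏ s ∈ (S.erase p).erase q, ordSign p s) *
    ∏ s ∈ (S.erase p).erase q, ordSign q s) * this

theorem ordSign_mul_ordSign_of_between {a b s : Fin n} (h1 : a < s) (h2 : s < b) :
    ordSign a s * ordSign b s = -1 := by
  rw [ordSign_of_lt h1, ordSign_of_gt h2]; norm_num

theorem ordSign_mul_ordSign_of_not_between {a b s : Fin n} (hab : a < b)
    (h : s < a ∨ b < s) : ordSign a s * ordSign b s = 1 := by
  rcases h with h | h
  · rw [ordSign_of_gt h, ordSign_of_gt (h.trans hab)]; norm_num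
  · rw [ordSign_of_lt h, ordSign_of_lt (hab.trans h)]; norm_num

namespace PartialMatching

variable {k : ℕ} (x : PartialMatching k n)

theorem mem_S {l : Fin n} : l ∈ x.S ↔ x.τ l ≠ l := by
  simp [S]

theorem τ_mem_S {l : Fin n} (h : l ∈ x.S) : x.τ l ∈ x.S := by
  rw [mem_S] at h ⊢
  rw [x.involutive]
  exact h.symm

theorem τ_injective : Function.Injective x.τ :=
  Function.LeftInverse.injective x.involutive

theorem τ_eq_iff {a b : Fin n} : x.τ a = b ↔ a = x.τ b :=
  ⟨fun h => by rw [← h, x.involutive], fun h => by rw [h, x.involutive]⟩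

variable {x}

theorem between_τ {a s : Fin n} (hsa : s ≠ a) (h1 : a < s) (h2 : s < x.τ a) :
    a < x.τ s ∧ x.τ s < x.τ a := by
  have h3 : x.τ s ≠ x.τ a := fun h => hsa (x.τ_injective h)
  have h4 : x.τ s ≠ a := fun h => h2.ne (x.τ_eq_iff.1 h)
  refine ⟨lt_of_not_ge fun h => ?_, lt_of_not_ge fun h => ?_⟩
  · exact x.noncrossing ⟨x.τ s, a, s, x.τ a, lt_of_le_of_ne h h4, h1, h2, x.involutive s, rfl⟩
  · exact x.noncrossing ⟨a, s, x.τ a, x.τ s, h1, h2, lt_of_le_of_ne h h3.symm, rfl, rfl⟩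

theorem outside_τ {a s : Fin n} (hsa : s ≠ a) (hsb : s ≠ x.τ a) (h : s < a ∨ x.τ a < s) :
    x.τ s < a ∨ x.τ a < x.τ s := by
  by_contra hc
  push Not at hc
  have h3 : x.τ s ≠ x.τ a := fun h => hsa (x.τ_injective h)
  have h4 : x.τ s ≠ a := fun h => hsb (x.τ_eq_iff.1 h)
  have := between_τ (x := x) h4 (lt_of_le_of_ne hc.1 h4.symm) (lt_of_le_of_ne hc.2 h3)
  rw [x.involutive] at this
  rcases h with h | h
  · exact absurd this.1 h.not_gt
  · exact absurd this.2 h.not_gt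

theorem ordSign_mul_ordSign_τ {a s : Fin n} (ha : a ∈ x.S) (hsa : s ≠ a) (hsb : s ≠ x.τ a) :
    ordSign a s * ordSign (x.τ a) s = ordSign a (x.τ s) * ordSign (x.τ a) (x.τ s) := by
  wlog hab : a < x.τ a generalizing a
  · have h := this (x.τ_mem_S ha) hsb (by rwa [x.involutive]) (by
      rw [x.involutive]
      exact lt_of_le_of_ne (not_lt.1 hab) ((x.mem_S).1 ha))
    rw [x.involutive] at h
    rw [mul_comm, h, mul_comm]
  by_cases hs : a < s ∧ s < x.τ a
  · have h := between_τ hsa hs.1 hs.2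
    rw [ordSign_mul_ordSign_of_between hs.1 hs.2, ordSign_mul_ordSign_of_between h.1 h.2]
  · have hs' : s < a ∨ x.τ a < s := by
      by_contra hc
      push Not at hc
      exact hs ⟨lt_of_le_of_ne hc.1 hsa.symm, lt_of_le_of_ne hc.2 hsb⟩
    rw [ordSign_mul_ordSign_of_not_between hab hs',
      ordSign_mul_ordSign_of_not_between hab (outside_τ hsa hsb hs')]

/-- There are evenly many matched elements strictly between the two ends of an arc. -/
theorem posSign_τ {a : Fin n} (ha : a ∈ x.S) : posSign x.S (x.τ a) = -posSign x.S a := by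
  have hne := (x.mem_S).1 ha
  have h1 : ∏ s ∈ (x.S.erase a).erase (x.τ a), ordSign a s * ordSign (x.τ a) s = 1 := by
    refine prod_involution (fun s _ => x.τ s) ?_ ?_ ?_ ?_
    · intro s hs
      simp only [mem_erase] at hs
      rw [← ordSign_mul_ordSign_τ ha hs.2.1 hs.1, mul_mul_mul_comm,
        ordSign_mul_self hs.2.1.symm, ordSign_mul_self hs.1.symm, one_mul]
    · intro s hs _
      simp only [mem_erase] at hs
      exact (x.mem_S).1 hs.2.2
    · intro s hs
      simp only [mem_erase] at hs ⊢
      refine ⟨fun h => hs.2.1 (x.τ_injective h), fun h => hs.1 (x.τ_eq_iff.1 h), x.τ_mem_S hs.2.2⟩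
    · intro s _
      exact x.involutive s
  rw [prod_ordSign_mul_ordSign ha (x.τ_mem_S ha) hne.symm] at h1
  have := posSign_mul_self x.S a
  linear_combination (-posSign x.S a) * h1 - posSign x.S (x.τ a) * this

end PartialMatching

/-- A set of labels on a circle with the property of cyclic intervals that two of its elements are
not separated by two elements of its complement. -/
def IsCyclicInterval (I : Fin n → Prop) : Prop :=
  ∀ a b c d : Fin n, a < b → b < c → c < d →
    ¬(I a ∧ ¬I b ∧ I c ∧ ¬I d) ∧ ¬(¬I a ∧ I b ∧ ¬I c ∧ I d)

theorem IsCyclicInterval.prod_ordSign {I : Fin n → Prop} (hI : IsCyclicInterval I)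
    {p q u v : Fin n} (hp : I p) (hq : I q) (hu : ¬I u) (hv : ¬I v) (hpq : p ≠ q) :
    ordSign p u * ordSign q u = ordSign p v * ordSign q v := by
  wlog hlt : p < q generalizing p q
  · rw [mul_comm, mul_comm (ordSign p v)]
    exact this hq hp hpq.symm (lt_of_le_of_ne (not_lt.1 hlt) hpq.symm)
  have hne : ∀ {a b : Fin n}, I a → ¬I b → a ≠ b := by
    rintro a b ha hb rfl
    exact hb ha
  have key : ∀ {u v : Fin n}, ¬I u → ¬I v → p < u → u < q → ¬(v < p ∨ q < v) := by
    rintro u v hu hv h1 h2 (h3 | h3)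
    · exact (hI v p u q h3 h1 h2).2 ⟨hv, hp, hu, hq⟩
    · exact (hI p u q v h1 h2 h3).1 ⟨hp, hu, hq, hv⟩
  have out : ∀ {u : Fin n}, ¬I u → ¬(p < u ∧ u < q) → u < p ∨ q < u := by
    intro u hu h
    by_contra hc
    push Not at hc
    exact h ⟨lt_of_le_of_ne hc.1 (hne hp hu), lt_of_le_of_ne hc.2 (hne hq hu).symm⟩
  by_cases h1 : p < u ∧ u < q <;> by_cases h2 : p < v ∧ v < q
  · rw [ordSign_mul_ordSign_of_between h1.1 h1.2, ordSign_mul_ordSign_of_between h2.1 h2.2]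
  · exact absurd (out hv h2) (key hu hv h1.1 h1.2)
  · exact absurd (out hu h1) (key hv hu h2.1 h2.2)
  · rw [ordSign_mul_ordSign_of_not_between hlt (out hu h1),
      ordSign_mul_ordSign_of_not_between hlt (out hv h2)]

namespace PartialMatching

variable {k : ℕ} {x : PartialMatching k n}

open Classical in
/-- Two arcs leave a cyclic interval `I`, from `p` and from `q`. The parity of the number of matched
elements strictly between `p` and `q` is that of the number of special arcs that separate the two
arcs: the other arcs contribute evenly, and every separating arc is special. -/
theorem neg_posSign_mul_posSign {I : Fin n → Prop} (hI : IsCyclicInterval I) {p q : Fin n}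
    (hpS : p ∈ x.S) (hqS : q ∈ x.S) (hpq : p ≠ q) (hp : I p) (hq : I q) (hp' : ¬I (x.τ p))
    (hq' : ¬I (x.τ q)) :
    -(posSign x.S p * posSign x.S q) = (-1) ^ (univ.filter fun a : Fin n => a < x.τ a ∧
      Xor (I a) (I (x.τ a)) ∧ (Separates a (x.τ a) p (x.τ p) q (x.τ q) ∨
        Separates a (x.τ a) q (x.τ q) p (x.τ p))).card := by
  have hne : ∀ {a b : Fin n}, I a → ¬I b → a ≠ b := by
    rintro a b ha hb rfl
    exact hb ha
  have hττ : x.τ p ≠ x.τ q := fun h => hpq (x.τ_injective h)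
  set S' := (((x.S.erase p).erase q).erase (x.τ p)).erase (x.τ q) with hS'
  have hmem : ∀ s, s ∈ S' ↔ s ≠ x.τ q ∧ s ≠ x.τ p ∧ s ≠ q ∧ s ≠ p ∧ s ∈ x.S := by
    intro s
    simp [hS']
  have hτ : ∀ s ∈ S', x.τ s ∈ S' := by
    intro s hs
    rw [hmem] at hs ⊢
    refine ⟨fun h => hs.2.2.1 (x.τ_injective h), fun h => hs.2.2.2.1 (x.τ_injective h),
      fun h => hs.1 (x.τ_eq_iff.1 h), fun h => hs.2.1 (x.τ_eq_iff.1 h), x.τ_mem_S hs.2.2.2.2⟩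
  set φ : Fin n → ℝ := fun s => ordSign p s * ordSign q s with hφ
  have h1 : -(posSign x.S p * posSign x.S q) = ∏ s ∈ S', φ s := by
    have hm1 : x.τ p ∈ (x.S.erase p).erase q := by
      simp only [mem_erase]
      exact ⟨(hne hq hp').symm, (hne hp hp').symm, x.τ_mem_S hpS⟩
    have hm2 : x.τ q ∈ ((x.S.erase p).erase q).erase (x.τ p) := by
      simp only [mem_erase]
      exact ⟨hττ.symm, (hne hq hq').symm, (hne hp hq').symm, x.τ_mem_S hqS⟩
    rw [← prod_ordSign_mul_ordSign hpS hqS hpq, ← mul_prod_erase _ φ hm1, ← mul_prod_erase _ φ hm2,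
      ← mul_assoc]
    simp only [hφ]
    rw [hI.prod_ordSign hp hq hp' hq' hpq, mul_mul_mul_comm,
      ordSign_mul_self (hne hp hq'), ordSign_mul_self (hne hq hq'), one_mul, one_mul]
  have h2 : ∏ s ∈ S', φ s = ∏ a ∈ S'.filter (fun a => a < x.τ a), φ a * φ (x.τ a) := by
    rw [← prod_filter_mul_prod_filter_not S' (fun a => a < x.τ a), 
      prod_mul_distrib (f := φ) (g := fun a => φ (x.τ a))]
    refine congrArg _ (Eq.symm ?_)
    refine prod_bij (fun a _ => x.τ a) ?_ ?_ ?_ ?_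
    · intro a ha
      rw [mem_filter] at ha ⊢
      rw [x.involutive]
      exact ⟨hτ a ha.1, ha.2.not_gt⟩
    · intro a _ b _ h
      exact x.τ_injective h
    · intro b hb
      rw [mem_filter] at hb
      refine ⟨x.τ b, ?_, x.involutive b⟩
      rw [mem_filter, x.involutive]
      have := (x.mem_S).1 ((hmem b).1 hb.1).2.2.2.2
      exact ⟨hτ b hb.1, lt_of_le_of_ne (not_lt.1 hb.2) this⟩
    · intro a _
      rfl
  have hin : ∀ {a s : Fin n}, a < s → s < x.τ a → ordSign s a * ordSign s (x.τ a) = -1 := by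
    intro a s h1 h2
    rw [ordSign_of_gt h1, ordSign_of_lt h2]; norm_num
  have hout : ∀ {a s : Fin n}, a < x.τ a → (s < a ∨ x.τ a < s) →
      ordSign s a * ordSign s (x.τ a) = 1 := by
    rintro a s h0 (h1 | h1)
    · rw [ordSign_of_lt h1, ordSign_of_lt (h1.trans h0)]; norm_num
    · rw [ordSign_of_gt h1, ordSign_of_gt (h0.trans h1)]; norm_num
  have h3 : ∀ a ∈ S'.filter (fun a => a < x.τ a), φ a * φ (x.τ a) =
      if Separates a (x.τ a) p (x.τ p) q (x.τ q) ∨ Separates a (x.τ a) q (x.τ q) p (x.τ p)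
      then -1 else 1 := by
    intro a ha
    rw [mem_filter, hmem] at ha
    obtain ⟨⟨ha1, ha2, ha3, ha4, _⟩, hlt⟩ := ha
    have e1 : φ a * φ (x.τ a) = (ordSign p a * ordSign p (x.τ a)) *
        (ordSign q a * ordSign q (x.τ a)) := by
      simp only [hφ]; ring
    have hpa : p ≠ x.τ a := fun h => ha2 (x.τ_eq_iff.1 h.symm)
    have hqa : q ≠ x.τ a := fun h => ha1 (x.τ_eq_iff.1 h.symm)
    have out : ∀ {u : Fin n}, u ≠ a → u ≠ x.τ a → ¬(a < u ∧ u < x.τ a) → u < a ∨ x.τ a < u := by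
      intro u hu1 hu2 h
      by_contra hc
      push Not at hc
      exact h ⟨lt_of_le_of_ne hc.1 hu1.symm, lt_of_le_of_ne hc.2 hu2⟩
    rw [e1]
    by_cases hpi : a < p ∧ p < x.τ a <;> by_cases hqi : a < q ∧ q < x.τ a
    · rw [if_neg, hin hpi.1 hpi.2, hin hqi.1 hqi.2]
      · norm_num
      · rintro (⟨_, _, h | h, _⟩ | ⟨_, _, h | h, _⟩)
        · exact absurd hqi.1 h.not_gt
        · exact absurd hqi.2 h.not_gt
        · exact absurd hpi.1 h.not_gt
        · exact absurd hpi.2 h.not_gt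
    · have ho := out ha3.symm hqa hqi
      rw [if_pos, hin hpi.1 hpi.2, hout hlt ho]
      · norm_num
      · exact Or.inl ⟨hpi, between_τ ha4.symm hpi.1 hpi.2, ho, outside_τ ha3.symm hqa ho⟩
    · have ho := out ha4.symm hpa hpi
      rw [if_pos, hin hqi.1 hqi.2, hout hlt ho]
      · norm_num
      · exact Or.inr ⟨hqi, between_τ ha3.symm hqi.1 hqi.2, ho, outside_τ ha4.symm hpa ho⟩
    · rw [if_neg, hout hlt (out ha4.symm hpa hpi), hout hlt (out ha3.symm hqa hqi)]
      · norm_num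
      · rintro (⟨h, _⟩ | ⟨h, _⟩)
        · exact hpi h
        · exact hqi h
  rw [h1, h2, prod_congr rfl h3, prod_ite, prod_const_one, mul_one, prod_const]
  congr 2
  ext a
  simp only [mem_filter, mem_univ, true_and, hmem]
  constructor
  · rintro ⟨⟨_, hlt⟩, hsep⟩
    refine ⟨hlt, ?_, hsep⟩
    -- an arc with both ends on one side of the boundary of `I` cannot separate the two arcs
    have hx : ∀ {p q : Fin n}, I p → I q → ¬I (x.τ p) → ¬I (x.τ q) →
        Separates a (x.τ a) p (x.τ p) q (x.τ q) → Xor (I a) (I (x.τ a)) := by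
      rintro p q hp hq hp' hq' ⟨⟨s1, s2⟩, ⟨s3, s4⟩, s5, s6⟩
      by_cases ha : I a <;> by_cases hb : I (x.τ a)
      · exfalso
        rcases s6 with s6 | s6
        · exact (hI _ _ _ _ s6 s3 s4).2 ⟨hq', ha, hp', hb⟩
        · exact (hI _ _ _ _ s3 s4 s6).1 ⟨ha, hp', hb, hq'⟩
      · exact Or.inl ⟨ha, hb⟩
      · exact Or.inr ⟨hb, ha⟩
      · exfalso
        rcases s5 with s5 | s5
        · exact (hI _ _ _ _ s5 s1 s2).1 ⟨hq, ha, hp, hb⟩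
        · exact (hI _ _ _ _ s1 s2 s5).2 ⟨ha, hp, hb, hq⟩
    rcases hsep with h | h
    · exact hx hp hq hp' hq' h
    · exact hx hq hp hq' hp' h
  · rintro ⟨hlt, _, hsep⟩
    have hx : ∀ {u v : Fin n}, Separates a (x.τ a) u (x.τ u) v (x.τ v) →
        (a ≠ u ∧ a ≠ x.τ u) ∧ a ≠ v ∧ a ≠ x.τ v := by
      rintro u v ⟨⟨s1, _⟩, ⟨s3, _⟩, s5, s6⟩
      exact ⟨⟨s1.ne, s3.ne⟩, s5.elim (fun h => h.ne') (fun h => (hlt.trans h).ne),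
        s6.elim (fun h => h.ne') (fun h => (hlt.trans h).ne)⟩
    have hS := (x.mem_S).2 hlt.ne'
    rcases hsep with h | h
    · obtain ⟨⟨h1, h2⟩, h3, h4⟩ := hx h
      exact ⟨⟨⟨h4, h2, h3, h1, hS⟩, hlt⟩, Or.inl h⟩
    · obtain ⟨⟨h1, h2⟩, h3, h4⟩ := hx h
      exact ⟨⟨⟨h2, h4, h1, h3, hS⟩, hlt⟩, Or.inr h⟩

end PartialMatching

/-! ### Straightening -/

/-- Every initial segment of `S` contains at least as many elements of `U` as of `S \ U`. -/
def IsBallot (S U : Finset (Fin n)) : Prop :=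
  ∀ t : Fin n, ((S \ U).filter (· ≤ t)).card ≤ (U.filter (· ≤ t)).card

/-- Summing the one-column relations over a larger set `V` counts each `m`-subset of `V` equally
often. -/
theorem sum_powersetCard_eq_zero {S : Finset (Fin n)} {m : ℕ} {g : Finset (Fin n) → ℝ}
    (hg : ∀ V ⊆ S, V.card = m + 1 → ∑ a ∈ V, g (V.erase a) = 0) (d : ℕ) :
    ∀ V ⊆ S, V.card = m + 1 + d → ∑ U ∈ V.powersetCard m, g U = 0 := by
  have hdc : ∀ V : Finset (Fin n), ∀ d : ℕ, V.card = m + 1 + d →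
      ∑ c ∈ V, ∑ U ∈ (V.erase c).powersetCard m, g U =
        (d + 1 : ℝ) * ∑ U ∈ V.powersetCard m, g U := by
    intro V d hV
    rw [sum_comm' (t' := V.powersetCard m) (s' := fun U => V \ U), mul_sum]
    · refine sum_congr rfl fun U hU => ?_
      rw [mem_powersetCard] at hU
      rw [sum_const, card_sdiff_of_subset hU.1, hU.2, hV, nsmul_eq_mul]
      congr 1
      have : m + 1 + d - m = d + 1 := by omega
      rw [this]
      push_cast
      ring
    · intro c U
      simp only [mem_powersetCard, mem_sdiff, subset_erase]
      tauto
  induction d with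
  | zero =>
    intro V hVS hV
    have h := hdc V 0 hV
    have h2 : ∀ c ∈ V, ∑ U ∈ (V.erase c).powersetCard m, g U = g (V.erase c) := by
      intro c hc
      have : (V.erase c).card = m := by rw [card_erase_of_mem hc, hV]; rfl
      rw [← this, powersetCard_self, sum_singleton]
    rw [sum_congr rfl h2, hg V hVS hV] at h
    simpa using h.symm
  | succ d ih =>
    intro V hVS hV
    have h := hdc V (d + 1) hV
    have h2 : ∀ c ∈ V, ∑ U ∈ (V.erase c).powersetCard m, g U = 0 := by
      intro c hc
      exact ih _ ((erase_subset _ _).trans hVS) (by rw [card_erase_of_mem hc, hV]; rfl)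
    rw [sum_congr rfl h2, sum_const_zero] at h
    rcases mul_eq_zero.1 h.symm with h | h
    · exact absurd h (by positivity)
    · exact h

/-- Garnir relations: only the elements of `V \ K` are exchanged. They follow from the case `K = ∅`
by removing the elements of `K` from the requirement `K ⊆ U` one at a time. -/
theorem sum_powersetCard_superset_eq_zero {S : Finset (Fin n)} {m : ℕ} {g : Finset (Fin n) → ℝ}
    (hg : ∀ V ⊆ S, V.card = m + 1 → ∑ a ∈ V, g (V.erase a) = 0) (K : Finset (Fin n)) :
    ∀ V ⊆ S, K ⊆ V → m + 1 ≤ (V \ K).card →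
      ∑ U ∈ V.powersetCard m with K ⊆ U, g U = 0 := by
  induction K using Finset.induction_on with
  | empty =>
    intro V hV _ hc
    simp only [empty_subset, filter_true]
    rw [sdiff_empty] at hc
    exact sum_powersetCard_eq_zero hg (V.card - (m + 1)) V hV (by omega)
  | insert c K hcK ih =>
    intro V hV hK hc
    have hcV : c ∈ V := hK (mem_insert_self _ _)
    have hKV : K ⊆ V := (subset_insert _ _).trans hK
    have h1 := ih V hV hKV (hc.trans (card_le_card (sdiff_subset_sdiff subset_rfl
      (subset_insert _ _))))
    have h2 := ih (V.erase c) ((erase_subset _ _).trans hV) (by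
      rw [subset_erase]; exact ⟨hKV, hcK⟩) (by
      rwa [show V.erase c \ K = V \ insert c K by
        ext; simp only [mem_sdiff, mem_erase, mem_insert]; tauto])
    rw [← sum_filter_add_sum_filter_not _ (fun U => c ∈ U), filter_filter, filter_filter] at h1
    have e1 : (V.powersetCard m).filter (fun U => K ⊆ U ∧ c ∈ U) =
        (V.powersetCard m).filter (fun U => insert c K ⊆ U) := by
      ext U
      simp only [mem_filter, insert_subset_iff]
      tauto
    have e2 : (V.powersetCard m).filter (fun U => K ⊆ U ∧ c ∉ U) =
        ((V.erase c).powersetCard m).filter (fun U => K ⊆ U) := by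
      ext U
      simp only [mem_filter, mem_powersetCard, subset_erase]
      tauto
    rw [e1, e2, h2, add_zero] at h1
    exact h1

/-- Straightening: the exchange relations express the value at any subset through the values at
ballot subsets. -/
theorem eq_zero_of_ballot {S : Finset (Fin n)} {m : ℕ} {g : Finset (Fin n) → ℝ}
    (hg : ∀ V ⊆ S, V.card = m + 1 → ∑ a ∈ V, g (V.erase a) = 0)
    (h0 : ∀ U ⊆ S, U.card = m → IsBallot S U → g U = 0) :
    ∀ U ⊆ S, U.card = m → g U = 0 := by
  intro U
  induction h : ∑ u ∈ U, (u : ℕ) using Nat.strong_induction_on generalizing U with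
  | _ w ih =>
    intro hU hm
    by_cases hb : IsBallot S U
    · exact h0 U hU hm hb
    simp only [IsBallot, not_forall, not_le] at hb
    obtain ⟨t, ht⟩ := hb
    -- up to `t`, `S` has fewer elements `K` in `U` than elements `D` outside: in the Garnir
    -- relation for `K` and `D ∪ U`, all subsets but `U` trade elements above `t` for elements of `D`
    set K := U.filter (· ≤ t) with hK
    set D := (S \ U).filter (· ≤ t) with hD
    have hKU : K ⊆ U := filter_subset _ _
    have hdis : Disjoint D U := by
      rw [disjoint_left]
      intro a ha
      simp only [hD, mem_filter, mem_sdiff] at ha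
      exact ha.1.2
    have hsum := sum_powersetCard_superset_eq_zero hg K (D ∪ U)
      (union_subset ((filter_subset _ _).trans sdiff_subset) hU) (hKU.trans subset_union_right) (by
        have h1 : (D ∪ U).card = D.card + U.card := card_union_of_disjoint hdis
        rw [card_sdiff_of_subset (hKU.trans subset_union_right), h1, hm]
        omega)
    rw [← sum_filter_add_sum_filter_not _ (fun U' => U' = U), filter_filter, filter_filter] at hsum
    have e1 : ((D ∪ U).powersetCard m).filter (fun U' => K ⊆ U' ∧ U' = U) = {U} := by
      ext U'
      simp only [mem_filter, mem_powersetCard, mem_singleton]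
      constructor
      · exact fun h => h.2.2
      · rintro rfl
        exact ⟨⟨subset_union_right, hm⟩, hKU, rfl⟩
    rw [e1, sum_singleton, sum_eq_zero, add_zero] at hsum
    · exact hsum
    intro U' hU'
    simp only [mem_filter, mem_powersetCard] at hU'
    obtain ⟨⟨hU'V, hU'm⟩, hKU', hne⟩ := hU'
    refine ih _ ?_ U' rfl (hU'V.trans (union_subset ((filter_subset _ _).trans sdiff_subset) hU))
      hU'm
    have hcard : (U' \ U).card = (U \ U').card := by
      rw [← Nat.add_left_cancel_iff (n := (U ∩ U').card), add_comm, add_comm (U ∩ U').card,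
        card_sdiff_add_card_inter, inter_comm, card_sdiff_add_card_inter, hm, hU'm]
    have hpos : 0 < (U \ U').card := by
      rw [card_pos, sdiff_nonempty]
      intro hs
      exact hne (eq_of_subset_of_card_le hs (by rw [hm, hU'm])).symm
    have h1 : ∑ u ∈ U' \ U, (u : ℕ) ≤ (U' \ U).card • (t : ℕ) := by
      refine sum_le_card_nsmul _ _ _ fun u hu => ?_
      rw [mem_sdiff] at hu
      rcases mem_union.1 (hU'V hu.1) with h | h
      · simp only [hD, mem_filter] at h
        exact h.2
      · exact absurd h hu.2
    have h2 : (U \ U').card • ((t : ℕ) + 1) ≤ ∑ u ∈ U \ U', (u : ℕ) := by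
      refine card_nsmul_le_sum _ _ _ fun u hu => ?_
      rw [mem_sdiff] at hu
      have : ¬u ≤ t := fun hut => hu.2 (hKU' (by simp [hK, hu.1, hut]))
      exact Nat.succ_le_of_lt (not_le.1 this)
    have h3 := sum_inter_add_sum_sdiff U U' (fun u : Fin n => (u : ℕ))
    have h4 := sum_inter_add_sum_sdiff U' U (fun u : Fin n => (u : ℕ))
    rw [inter_comm] at h4
    rw [smul_eq_mul] at h1 h2
    rw [hcard] at h1
    have : (U \ U').card * ((t : ℕ) + 1) = (U \ U').card * (t : ℕ) + (U \ U').card := by ring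
    rw [← h]
    omega

/-! ### The non-crossing matching with given left endpoints -/

/-- A ballot subset is the set of left endpoints of a non-crossing matching. -/
theorem exists_noncrossing (m : ℕ) : ∀ {S U : Finset (Fin n)}, U ⊆ S → S.card = 2 * m →
    U.card = m → IsBallot S U → ∃ τ : Fin n → Fin n, (∀ l, τ (τ l) = l) ∧
      (¬ ∃ a b c d : Fin n, a < b ∧ b < c ∧ c < d ∧ τ a = c ∧ τ b = d) ∧
      (∀ l, τ l ≠ l ↔ l ∈ S) ∧ ∀ l ∈ S, l < τ l ↔ l ∈ U := by
  induction m with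
  | zero =>
    intro S U _ hS _ _
    have : S = ∅ := by simpa using hS
    subst this
    refine ⟨id, fun _ => rfl, ?_, by simp, by simp⟩
    rintro ⟨a, b, c, d, h1, h2, _, h4, _⟩
    exact absurd h4 (h1.trans h2).ne
  | succ m ih =>
    intro S U hU hS hUc hb
    have hne : (S \ U).Nonempty := by
      rw [← card_pos, card_sdiff_of_subset hU]
      omega
    -- `d` is the first right endpoint, and its partner `u` is the last element of `S` before it
    set d := (S \ U).min' hne with hd
    have hdm : d ∈ S \ U := min'_mem _ _
    obtain ⟨hdS, hdU⟩ := mem_sdiff.1 hdm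
    have hne' : (U.filter (· ≤ d)).Nonempty := by
      rw [← card_pos]
      refine lt_of_lt_of_le ?_ (hb d)
      rw [card_pos]
      exact ⟨d, by simp [hdS, hdU]⟩
    set u := (U.filter (· ≤ d)).max' hne' with hu
    have hum : u ∈ U.filter (· ≤ d) := max'_mem _ _
    obtain ⟨huU, hud'⟩ := mem_filter.1 hum
    have hud : u < d := lt_of_le_of_ne hud' fun h => hdU (h ▸ huU)
    have huS := hU huU
    have hmid : ∀ l ∈ S, u < l → ¬ l < d := by
      intro l hl h1 h2
      by_cases hlU : l ∈ U
      · exact absurd (le_max' _ l (by simp [hlU, h2.le])) h1.not_ge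
      · exact absurd (min'_le (S \ U) l (by simp [hl, hlU])) h2.not_ge
    have hS'c : ((S.erase u).erase d).card = 2 * m := by
      rw [card_erase_of_mem (mem_erase.2 ⟨hud.ne', hdS⟩), card_erase_of_mem huS, hS]
      omega
    have hU'S : U.erase u ⊆ (S.erase u).erase d := by
      intro l hl
      simp only [mem_erase] at hl ⊢
      exact ⟨fun h => hdU (h ▸ hl.2), hl.1, hU hl.2⟩
    obtain ⟨τ, h1, h2, h3, h4⟩ := ih hU'S hS'c (by rw [card_erase_of_mem huU, hUc]; rfl) (by
      intro t
      have e1 : (S.erase u).erase d \ U.erase u = (S \ U).erase d := by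
        ext l
        simp only [mem_sdiff, mem_erase]
        constructor
        · rintro ⟨⟨ha, hb, hc⟩, hd⟩
          exact ⟨ha, hc, fun h => hd ⟨hb, h⟩⟩
        · rintro ⟨ha, hb, hc⟩
          exact ⟨⟨ha, fun h => hc (h ▸ huU), hb⟩, fun h => hc h.2⟩
      rw [e1, filter_erase, filter_erase]
      by_cases htd : d ≤ t
      · rw [card_erase_of_mem (by simp [hdS, hdU, htd]),
          card_erase_of_mem (by simp [huU, hud.le.trans htd])]
        exact Nat.sub_le_sub_right (hb t) 1
      · rw [card_eq_zero.2 _]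
        · exact Nat.zero_le _
        · rw [eq_empty_iff_forall_notMem]
          intro l hl
          simp only [mem_erase, mem_filter] at hl
          exact htd ((min'_le (S \ U) l hl.2.1).trans hl.2.2))
    have hτu : τ u = u := by
      by_contra h
      have := (h3 u).1 h
      simp at this
    have hτd : τ d = d := by
      by_contra h
      have := (h3 d).1 h
      simp at this
    have hτ : ∀ l, l ≠ u → l ≠ d → τ l ≠ u ∧ τ l ≠ d := by
      intro l hlu hld
      refine ⟨fun h => hlu ?_, fun h => hld ?_⟩
      · rw [← h1 l, h, hτu]
      · rw [← h1 l, h, hτd]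
    set σ : Fin n → Fin n := fun l => if l = u then d else if l = d then u else τ l with hσ
    have σu : σ u = d := by simp [hσ]
    have σd : σ d = u := by simp [hσ, hud.ne']
    have σo : ∀ l, l ≠ u → l ≠ d → σ l = τ l := fun l h h' => by simp [hσ, h, h']
    have σinv : ∀ l, σ (σ l) = l := by
      intro l
      by_cases hlu : l = u
      · rw [hlu, σu, σd]
      by_cases hld : l = d
      · rw [hld, σd, σu]
      · rw [σo l hlu hld, σo _ (hτ l hlu hld).1 (hτ l hlu hld).2, h1]
    have hfix : ∀ l, σ l ≠ l ↔ l ∈ S := by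
      intro l
      by_cases hlu : l = u
      · rw [hlu, σu]
        exact ⟨fun _ => huS, fun _ => hud.ne'⟩
      by_cases hld : l = d
      · rw [hld, σd]
        exact ⟨fun _ => hdS, fun _ => hud.ne⟩
      · rw [σo l hlu hld, h3, mem_erase, mem_erase]
        exact ⟨fun h => h.2.2, fun h => ⟨hld, hlu, h⟩⟩
    refine ⟨σ, σinv, ?_, hfix, ?_⟩
    · rintro ⟨a, b, c, e, hab, hbc, hce, hac, hbe⟩
      have hbS : b ∈ S := (hfix b).1 (by rw [hbe]; exact (hbc.trans hce).ne')
      have hcS : c ∈ S := (hfix c).1 (by rw [← hac, σinv, hac]; exact (hab.trans hbc).ne)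
      by_cases hau : a = u
      · rw [hau, σu] at hac
        rw [hau] at hab
        exact hmid b hbS hab (hac ▸ hbc)
      by_cases had : a = d
      · rw [had, σd] at hac
        exact absurd (hab.trans hbc) (by rw [had, ← hac]; exact hud.not_gt)
      by_cases hbu : b = u
      · rw [hbu, σu] at hbe
        rw [hbu] at hbc
        exact hmid c hcS hbc (hbe ▸ hce)
      by_cases hbd : b = d
      · rw [hbd, σd] at hbe
        exact absurd (hbc.trans hce) (by rw [hbd, ← hbe]; exact hud.not_gt)
      rw [σo a hau had] at hac
      rw [σo b hbu hbd] at hbe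
      exact h2 ⟨a, b, c, e, hab, hbc, hce, hac, hbe⟩
    · intro l hl
      by_cases hlu : l = u
      · rw [hlu, σu]
        exact ⟨fun _ => huU, fun _ => hud⟩
      by_cases hld : l = d
      · rw [hld, σd]
        exact ⟨fun h => absurd h hud.not_gt, fun h => absurd h hdU⟩
      · rw [σo l hlu hld, h4 l (by simp [hlu, hld, hl]), mem_erase]
        exact ⟨fun h => h.2, fun h => ⟨hlu, h⟩⟩

/-! ### Existence and uniqueness of the Temperley–Lieb immanants -/

namespace PartialMatching

variable {k : ℕ} (x : PartialMatching k n)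

/-- `U` contains exactly one endpoint of each arc, and nothing else. -/
def IsTransversal (U : Finset (Fin n)) : Prop :=
  U ⊆ x.S ∧ ∀ l ∈ x.S, x.τ l ∈ U ↔ l ∉ U

/-- The left endpoints of the arcs. -/
def left : Finset (Fin n) :=
  univ.filter fun l => l < x.τ l

variable {x}

theorem mem_left {l : Fin n} : l ∈ x.left ↔ l < x.τ l := by
  simp [left]

theorem left_subset : x.left ⊆ x.S := fun _ h => x.mem_S.2 (mem_left.1 h).ne'

theorem isTransversal_left : x.IsTransversal x.left := by
  refine ⟨left_subset, fun l hl => ?_⟩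
  rw [mem_left, mem_left, x.involutive, not_lt]
  exact ⟨le_of_lt, fun h => lt_of_le_of_ne h (x.mem_S.1 hl)⟩

theorem IsTransversal.image_τ {U : Finset (Fin n)} (hU : x.IsTransversal U) :
    U.image x.τ = x.S \ U := by
  ext l
  simp only [mem_image, mem_sdiff]
  constructor
  · rintro ⟨a, ha, rfl⟩
    have haS := hU.1 ha
    exact ⟨x.τ_mem_S haS, fun h => ((hU.2 a haS).1 h) ha⟩
  · rintro ⟨hl, hlU⟩
    exact ⟨x.τ l, (hU.2 l hl).2 hlU, x.involutive l⟩

theorem isTransversal_iff {U : Finset (Fin n)} (hU : U ⊆ x.S) :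
    x.IsTransversal U ↔ U.image x.τ = x.S \ U := by
  refine ⟨fun h => h.image_τ, fun h => ⟨hU, fun l hl => ⟨fun h1 h2 => ?_, fun h1 => ?_⟩⟩⟩
  · have := mem_image_of_mem x.τ h2
    rw [h, mem_sdiff] at this
    exact this.2 h1
  · have : l ∈ U.image x.τ := by rw [h, mem_sdiff]; exact ⟨hl, h1⟩
    obtain ⟨a, ha, rfl⟩ := mem_image.1 this
    rwa [x.involutive]

theorem disjoint_T_S : Disjoint x.T x.S := by
  rw [disjoint_left]
  exact fun l h h' => x.mem_S.1 h' (x.disjoint l h)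

theorem IsTransversal.card {U : Finset (Fin n)} (hU : x.IsTransversal U) :
    x.T.card + U.card = k := by
  have h1 := card_image_of_injective U x.τ_injective
  rw [hU.image_τ, card_sdiff_of_subset hU.1] at h1
  have h2 := card_le_card hU.1
  have h3 := x.card_eq
  change 2 * x.T.card + x.S.card = 2 * k at h3
  omega

theorem compatible_iff {A B : Finset (Fin n)} : x.Compatible A B ↔
    x.T = A ∩ B ∧ x.S = (A \ B) ∪ (B \ A) ∧ x.IsTransversal (A \ B) := by
  unfold Compatible
  refine and_congr_right fun _ => and_congr_right fun h => ?_
  rw [isTransversal_iff (by rw [h]; exact subset_union_left), h]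
  have : (A \ B ∪ B \ A) \ (A \ B) = B \ A := by
    ext l; simp only [mem_sdiff, mem_union]; tauto
  rw [this]

theorem compatible_union_iff {T S U : Finset (Fin n)} (hTS : Disjoint T S) (hU : U ⊆ S) :
    x.Compatible (T ∪ U) (T ∪ (S \ U)) ↔ x.T = T ∧ x.S = S ∧ x.IsTransversal U := by
  have hd : ∀ l, l ∈ T → l ∉ S := fun l h => disjoint_left.1 hTS h
  have hU' : ∀ l, l ∈ U → l ∈ S := fun l h => hU h
  have e1 : (T ∪ U) ∩ (T ∪ (S \ U)) = T := by
    ext l; simp only [mem_inter, mem_union, mem_sdiff]; tauto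
  have e2 : (T ∪ U) \ (T ∪ (S \ U)) = U := by
    ext l
    have := hd l
    have := hU' l
    simp only [mem_union, mem_sdiff]; tauto
  have e3 : (T ∪ (S \ U)) \ (T ∪ U) = S \ U := by
    ext l
    have := hd l
    simp only [mem_union, mem_sdiff]; tauto
  rw [compatible_iff, e1, e2, e3, union_sdiff_of_subset hU]

/-- The left endpoints determine the arcs: at the first right endpoint with two different partners,
one of the partners would be matched to an earlier right endpoint. -/
theorem τ_eq_of_left_eq {y : PartialMatching k n} (hS : x.S = y.S) (hl : x.left = y.left) :
    x.τ = y.τ := by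
  have hlr : ∀ l, l < x.τ l ↔ l < y.τ l := fun l => by rw [← mem_left, ← mem_left, hl]
  have hrr : ∀ l, x.τ l < l ↔ y.τ l < l := by
    intro l
    have h1 : x.τ l ≠ l ↔ y.τ l ≠ l := by rw [← mem_S, ← mem_S, hS]
    have h2 := hlr l
    constructor
    · intro h
      exact lt_of_le_of_ne (not_lt.1 fun h' => h.not_gt (h2.2 h')) (h1.1 h.ne)
    · intro h
      exact lt_of_le_of_ne (not_lt.1 fun h' => h.not_gt (h2.1 h')) (h1.2 h.ne)
  have key : ∀ d, x.τ d < d → x.τ d = y.τ d := by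
    intro d
    induction d using WellFoundedLT.induction with
    | ind d ih =>
    intro hd
    have hd' := (hrr d).1 hd
    rcases lt_trichotomy (x.τ d) (y.τ d) with h | h | h
    · exfalso
      set b := y.τ d with hb
      have hyb : y.τ b = d := y.involutive d
      have hbt := between_τ (x := x) (a := x.τ d) (s := b) h.ne' h (by rwa [x.involutive])
      rw [x.involutive] at hbt
      have hbl : b < x.τ b := (hlr b).2 (by rwa [hyb])
      have := ih (x.τ b) hbt.2 (by rwa [x.involutive])
      rw [x.involutive, ← y.τ_eq_iff, hyb] at this
      exact hbt.2.ne this.symm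
    · exact h
    · exfalso
      set b := x.τ d with hb
      have hyb : x.τ b = d := x.involutive d
      have hbt := between_τ (x := y) (a := y.τ d) (s := b) h.ne' h (by rwa [y.involutive])
      rw [y.involutive] at hbt
      have hbl : b < y.τ b := (hlr b).1 (by rwa [hyb])
      have := ih (y.τ b) hbt.2 ((hrr _).2 (by rwa [y.involutive]))
      rw [y.involutive, x.τ_eq_iff, hyb] at this
      exact hbt.2.ne this
  funext l
  rcases lt_trichotomy l (x.τ l) with h | h | h
  · have := key (x.τ l) (by rwa [x.involutive])
    rw [x.involutive] at this
    exact (y.τ_eq_iff.2 this).symm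
  · by_contra hne
    have : l ∉ x.S := fun h' => x.mem_S.1 h' h.symm
    rw [hS, mem_S, not_not] at this
    exact hne (by rw [this, ← h])
  · exact key l h

/-- The left endpoints of `y` are weakly to the left of any transversal, so that the pair of
`k`-subsets built from the left endpoints of `x` sees `x` and matchings of smaller weight only. -/
theorem sum_left_lt {y : PartialMatching k n} {x : PartialMatching k n} (hT : y.T = x.T)
    (hS : y.S = x.S) (hU : y.IsTransversal x.left) (hne : y ≠ x) :
    ∑ l ∈ y.left, (l : ℕ) < ∑ l ∈ x.left, (l : ℕ) := by
  classical
  have h1 : ∑ l ∈ x.left, (l : ℕ) =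
      ∑ l ∈ y.left, ((if l ∈ x.left then l else y.τ l : Fin n) : ℕ) := by
    symm
    refine sum_bij (fun l _ => if l ∈ x.left then l else y.τ l) ?_ ?_ ?_ ?_
    · intro l hl
      split_ifs with h
      · exact h
      · exact (hU.2 l (left_subset hl)).2 h
    · intro a ha b hb hab
      rw [mem_left] at ha hb
      split_ifs at hab with h1 h2 h2
      · exact hab
      · rw [hab, y.involutive] at ha
        exact absurd ha hb.not_gt
      · rw [← hab, y.involutive] at hb
        exact absurd ha hb.not_gt
      · exact y.τ_injective hab
    · intro b hb
      by_cases h : b < y.τ b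
      · exact ⟨b, mem_left.2 h, by rw [if_pos hb]⟩
      · have hbS := hU.1 hb
        refine ⟨y.τ b, mem_left.2 ?_, ?_⟩
        · rw [y.involutive]
          exact lt_of_le_of_ne (not_lt.1 h) (y.mem_S.1 hbS)
        · rw [if_neg, y.involutive]
          exact fun h' => ((hU.2 b hbS).1 h') hb
    · intro l _
      rfl
  rw [h1]
  have hle : ∀ l ∈ y.left, (l : ℕ) ≤ ((if l ∈ x.left then l else y.τ l : Fin n) : ℕ) := by
    intro l hl
    split_ifs
    · exact le_rfl
    · exact (mem_left.1 hl).le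
  refine sum_lt_sum hle ?_
  by_contra hc
  push Not at hc
  have hsub : y.left ⊆ x.left := by
    intro l hl
    by_contra h
    have := hc l hl
    rw [if_neg h] at this
    exact absurd (mem_left.1 hl) (not_lt.2 this)
  have hsub' : x.left ⊆ y.left := by
    intro l hl
    by_contra h
    have hlS := hU.1 hl
    have : y.τ l ∈ y.left := by
      rw [mem_left, y.involutive]
      exact lt_of_le_of_ne (not_lt.1 fun h' => h (mem_left.2 h')) (y.mem_S.1 hlS)
    exact ((hU.2 l hlS).1 (hsub this)) hl
  exact hne (PartialMatching.ext (τ_eq_of_left_eq hS (hsub.antisymm hsub')) hT)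

theorem compatible_left_iff {y : PartialMatching k n} :
    y.Compatible (x.T ∪ x.left) (x.T ∪ (x.S \ x.left)) ↔
      y.T = x.T ∧ y.S = x.S ∧ y.IsTransversal x.left :=
  compatible_union_iff disjoint_T_S left_subset

open Classical in
theorem eq_zero_of_sum_compatible_left {F : PartialMatching k n → ℝ}
    (hF : ∀ x : PartialMatching k n, ∑ y : PartialMatching k n with
      y.Compatible (x.T ∪ x.left) (x.T ∪ (x.S \ x.left)), F y = 0) : F = 0 := by
  funext x
  induction h : ∑ l ∈ x.left, (l : ℕ) using Nat.strong_induction_on generalizing x with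
  | _ w ih =>
    have hx := hF x
    rw [sum_eq_single_of_mem x] at hx
    · exact hx
    · simp [compatible_left_iff, isTransversal_left]
    · intro y hy hne
      simp only [mem_filter, mem_univ, true_and, compatible_left_iff] at hy
      exact ih _ (h ▸ sum_left_lt hy.1 hy.2.1 hy.2.2 hne) y rfl

open Classical in
theorem exists_sum_compatible_left (f : PartialMatching k n → ℝ) :
    ∃ F : PartialMatching k n → ℝ, ∀ x : PartialMatching k n, ∑ y : PartialMatching k n with
      y.Compatible (x.T ∪ x.left) (x.T ∪ (x.S \ x.left)), F y = f x := by
  let L : (PartialMatching k n → ℝ) →ₗ[ℝ] (PartialMatching k n → ℝ) :=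
    { toFun := fun F x => ∑ y : PartialMatching k n with
        y.Compatible (x.T ∪ x.left) (x.T ∪ (x.S \ x.left)), F y
      map_add' := fun F G => by funext x; simp [sum_add_distrib]
      map_smul' := fun c F => by funext x; simp [mul_sum] }
  have hL : Function.Injective L := by
    rw [← LinearMap.ker_eq_bot, LinearMap.ker_eq_bot']
    intro F hF
    exact eq_zero_of_sum_compatible_left fun x => congrFun hF x
  obtain ⟨F, hF⟩ := LinearMap.injective_iff_surjective.1 hL f
  exact ⟨F, fun x => congrFun hF x⟩

theorem IsTransversal.erase_τ {V : Finset (Fin n)} {a : Fin n} (ha : a ∈ V) (hV : V ⊆ x.S)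
    (h : x.IsTransversal (V.erase a)) : x.τ a ∈ V ∧ x.IsTransversal (V.erase (x.τ a)) := by
  have haS := hV ha
  have h1 : x.τ a ∈ V.erase a := (h.2 a haS).2 (by simp)
  have h2 : x.τ a ∈ V := mem_of_mem_erase h1
  refine ⟨h2, (erase_subset _ _).trans hV, fun l hl => ?_⟩
  by_cases hla : l = a
  · subst hla
    have := x.mem_S.1 haS
    simp [ha, this.symm]
  · by_cases hlb : l = x.τ a
    · subst hlb
      rw [x.involutive]
      simp [ha, (x.mem_S.1 haS).symm]
    · have := h.2 l hl
      have h3 : x.τ l ≠ x.τ a := fun h => hla (x.τ_injective h)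
      have h4 : x.τ l ≠ a := fun h => hlb (x.τ_eq_iff.1 h)
      simpa [hla, hlb, h3, h4] using this

open Classical in
/-- The indicator function of the transversals satisfies the same signed exchange relations as
products of two minors. -/
theorem sum_posSign_isTransversal {V : Finset (Fin n)} (hV : V ⊆ x.S) :
    ∑ a ∈ V with x.IsTransversal (V.erase a), posSign x.S a = 0 := by
  refine sum_involution (fun a _ => x.τ a) ?_ ?_ ?_ ?_
  · intro a ha
    rw [posSign_τ (hV (mem_filter.1 ha).1), add_neg_cancel]
  · intro a ha _
    exact x.mem_S.1 (hV (mem_filter.1 ha).1)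
  · intro a ha
    rw [mem_filter] at ha ⊢
    exact ha.2.erase_τ ha.1 hV
  · intro a _
    exact x.involutive a

end PartialMatching

/-- The Plücker relations for `(T ⊔ V, T ⊔ (S \ V))`. -/
theorem sum_posSign_plucker (M : Matrix (Fin (r + 1)) (Fin n) ℝ) {T S V : Finset (Fin n)} {m : ℕ}
    (hTS : Disjoint T S) (hS : S.card = 2 * m) (hT : T.card + m = r + 1) (hV : V ⊆ S)
    (hVc : V.card = m + 1) :
    ∑ a ∈ V, posSign S a * (plucker M (T ∪ V.erase a) * plucker M (T ∪ (S \ V.erase a))) = 0 := by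
  have hTV : Disjoint T V := hTS.mono_right hV
  have hle := card_le_card hV
  have hrel := plucker_relation M (A := T ∪ V) (B := T ∪ (S \ V))
    (by rw [card_union_of_disjoint hTV]; omega)
    (by rw [card_union_of_disjoint (hTS.mono_right sdiff_subset), card_sdiff_of_subset hV]; omega)
  rw [sum_union hTV, sum_eq_zero, zero_add] at hrel
  · rw [← hrel]
    refine sum_congr rfl fun a ha => ?_
    have haT : a ∉ T := fun h => disjoint_left.1 hTV h ha
    have e1 : (T ∪ V).erase a = T ∪ V.erase a := by
      rw [erase_union_distrib, erase_eq_of_notMem haT]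
    have e2 : insert a (T ∪ (S \ V)) = T ∪ (S \ V.erase a) := by
      have := hV ha
      ext l
      simp only [mem_insert, mem_union, mem_sdiff, mem_erase]
      by_cases hla : l = a
      · subst hla; tauto
      · tauto
    rw [e2, ← e1]
    congr 1
    have e3 : S.erase a = V.erase a ∪ (S \ V) := by
      ext l
      have := @hV l
      simp only [mem_erase, mem_union, mem_sdiff]
      by_cases hla : l = a
      · subst hla; tauto
      · tauto
    have d1 : Disjoint (V.erase a) (S \ V) := disjoint_sdiff.mono_left (erase_subset _ _)
    rw [posSign, posSign, e1, e3, prod_union d1, prod_union (hTV.mono_right (erase_subset _ _)),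
      prod_union (hTS.mono_right sdiff_subset)]
    have hsq : (∏ b ∈ T, ordSign a b) * ∏ b ∈ T, ordSign a b = 1 := by
      rw [← prod_mul_distrib]
      refine prod_eq_one fun b hb => ordSign_mul_self ?_
      rintro rfl
      exact haT hb
    linear_combination (-(∏ b ∈ V.erase a, ordSign a b) * ∏ b ∈ S \ V, ordSign a b) * hsq
  · intro a ha
    rw [prod_eq_zero (s := T ∪ (S \ V)) (mem_union_left _ ha) (ordSign_self a)]
    simp

/-- Products of two minors expand uniquely: the left endpoints determine the family, and
straightening extends the defining relations from ballot pairs to all pairs. -/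
theorem existsUnique_isTLFamily (M : Matrix (Fin (r + 1)) (Fin n) ℝ) :
    ∃! F : PartialMatching (r + 1) n → ℝ, IsTLFamily M F := by
  classical
  obtain ⟨F, hF⟩ := PartialMatching.exists_sum_compatible_left (fun x : PartialMatching (r + 1) n =>
    plucker M (x.T ∪ x.left) * plucker M (x.T ∪ (x.S \ x.left)))
  refine ⟨F, ?_, ?_⟩
  · intro A B hA hB
    set T := A ∩ B with hTdef
    set S := (A \ B) ∪ (B \ A) with hSdef
    set m := (A \ B).card with hm
    have hTS : Disjoint T S := by
      rw [disjoint_left]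
      intro l
      simp only [hTdef, hSdef, mem_inter, mem_union, mem_sdiff]
      tauto
    have hTm : T.card + m = r + 1 := by
      rw [← hA, ← card_sdiff_add_card_inter A B, add_comm]
    have hSc : S.card = 2 * m := by
      have : (B \ A).card = m := by
        have := card_sdiff_add_card_inter B A
        rw [inter_comm] at this
        change _ + T.card = _ at this
        omega
      rw [hSdef, card_union_of_disjoint, this]
      · omega
      · exact disjoint_sdiff_sdiff
    set h : Finset (Fin n) → ℝ := fun U => plucker M (T ∪ U) * plucker M (T ∪ (S \ U)) -
      ∑ y : PartialMatching (r + 1) n with y.T = T ∧ y.S = S ∧ y.IsTransversal U, F y with hh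
    have hrel : ∀ V ⊆ S, V.card = m + 1 → ∑ a ∈ V, posSign S a * h (V.erase a) = 0 := by
      intro V hV hVc
      simp only [hh, mul_sub, sum_sub_distrib]
      rw [sum_posSign_plucker M hTS hSc hTm hV hVc, zero_sub, neg_eq_zero]
      simp only [sum_filter, mul_sum]
      rw [sum_comm]
      refine sum_eq_zero fun y _ => ?_
      by_cases hy : y.T = T ∧ y.S = S
      · have := PartialMatching.sum_posSign_isTransversal (x := y) (V := V) (by rw [hy.2]; exact hV)
        rw [hy.2, sum_filter] at this
        simp only [hy, true_and]
        calc _ = (∑ a ∈ V, if y.IsTransversal (V.erase a) then posSign S a else 0) * F y := by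
              rw [sum_mul]
              refine sum_congr rfl fun a _ => ?_
              split_ifs <;> simp
          _ = 0 := by rw [this, zero_mul]
      · refine sum_eq_zero fun a _ => ?_
        rw [if_neg (fun h => hy ⟨h.1, h.2.1⟩), mul_zero]
    have hzero := eq_zero_of_ballot (S := S) (m := m)
      (g := fun U => (∏ a ∈ U, posSign S a) * h U) (by
        intro V hV hVc
        have e : ∀ a ∈ V, (∏ b ∈ V.erase a, posSign S b) * h (V.erase a) =
            (∏ b ∈ V, posSign S b) * (posSign S a * h (V.erase a)) := by
          intro a ha
          rw [← mul_prod_erase V _ ha]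
          linear_combination (-(∏ b ∈ V.erase a, posSign S b) * h (V.erase a)) *
            posSign_mul_self S a
        rw [sum_congr rfl e, ← mul_sum, hrel V hV hVc, mul_zero]) (by
        intro U hU hUc hb
        obtain ⟨τ, h1, h2, h3, h4⟩ := exists_noncrossing m hU hSc hUc hb
        have hSe : (univ.filter fun l => τ l ≠ l) = S := by
          ext l; simp [← h3]
        let x : PartialMatching (r + 1) n := ⟨τ, T, h1, h2, (by
          intro l hl
          by_contra hne
          exact disjoint_left.1 hTS hl ((h3 l).1 hne)), (by rw [hSe]; omega)⟩
        have hxS : x.S = S := hSe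
        have hxl : x.left = U := by
          ext l
          rw [PartialMatching.mem_left]
          constructor
          · intro hl
            exact (h4 l ((h3 l).1 hl.ne')).1 hl
          · intro hl
            exact (h4 l (hU hl)).2 hl
        have hx := hF x
        rw [filter_congr fun y _ => PartialMatching.compatible_left_iff, hxS, hxl] at hx
        change _ * h U = 0
        simp only [hh]
        rw [mul_eq_zero, sub_eq_zero]
        exact Or.inr hx.symm)
    have hU := hzero (A \ B) subset_union_left rfl
    have hne : (∏ a ∈ A \ B, posSign S a) ≠ 0 := by
      rw [prod_ne_zero_iff]
      exact fun a _ => posSign_ne_zero S a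
    have hU' := (mul_eq_zero.1 hU).resolve_left hne
    simp only [hh] at hU'
    have e1 : T ∪ A \ B = A := by
      ext l; simp only [hTdef, mem_union, mem_inter, mem_sdiff]; tauto
    have e2 : T ∪ (S \ (A \ B)) = B := by
      ext l; simp only [hTdef, hSdef, mem_union, mem_inter, mem_sdiff]; tauto
    rw [e1, e2, sub_eq_zero] at hU'
    rw [hU']
    refine sum_congr ?_ fun _ _ => rfl
    ext y
    simp only [mem_filter, mem_univ, true_and, PartialMatching.compatible_iff]
    exact Iff.rfl
  · intro G hG
    rw [← sub_eq_zero]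
    refine PartialMatching.eq_zero_of_sum_compatible_left fun x => ?_
    have hc1 := x.isTransversal_left.card
    have hc2 : (x.T ∪ (x.S \ x.left)).card = r + 1 := by
      rw [card_union_of_disjoint (x.disjoint_T_S.mono_right sdiff_subset),
        ← x.isTransversal_left.image_τ, card_image_of_injective _ x.τ_injective, hc1]
    have := hG (x.T ∪ x.left) (x.T ∪ (x.S \ x.left))
      (by rw [card_union_of_disjoint (x.disjoint_T_S.mono_right x.left_subset), hc1]) hc2
    simp only [Pi.sub_apply, sum_sub_distrib]
    rw [hF x, sub_eq_zero]
    convert this.symm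

/-! ### Intersections of a row span with an orthogonal complement -/

theorem det_mul_transpose_self_ne_zero {M : Matrix (Fin r) (Fin n) ℝ}
    (hM : LinearIndependent ℝ M.row) : (M * Mᵀ).det ≠ 0 := by
  intro h0
  obtain ⟨v, hv, h⟩ := Matrix.exists_vecMul_eq_zero_iff.2 h0
  have h1 : (v ᵥ* M) ⬝ᵥ (v ᵥ* M) = 0 := by
    rw [← dotProduct_mulVec, ← vecMul_transpose, vecMul_vecMul, h, dotProduct_zero]
  rw [dotProduct_self_eq_zero, vecMul_eq_sum] at h1
  exact hv (funext (Fintype.linearIndependent_iff.1 hM v h1))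

theorem exists_plucker_ne_zero {M : Matrix (Fin r) (Fin n) ℝ} (hM : LinearIndependent ℝ M.row) :
    ∃ I : Finset (Fin n), plucker M I ≠ 0 := by
  by_contra h
  push Not at h
  apply det_mul_transpose_self_ne_zero hM
  rw [det_mul_transpose_self]
  exact sum_eq_zero fun I _ => by rw [h I]; norm_num

theorem mem_perp_rowSpan {M : Matrix (Fin r) (Fin n) ℝ} {v : Fin n → ℝ} :
    v ∈ perp (rowSpan M) ↔ ∀ i, v ⬝ᵥ M i = 0 := by
  constructor
  · intro h i
    exact h _ (Submodule.subset_span ⟨i, rfl⟩)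
  · intro h w hw
    induction hw using Submodule.span_induction with
    | mem w hw => obtain ⟨i, rfl⟩ := hw; exact h i
    | zero => simp
    | add a b _ _ ha hb => rw [dotProduct_add, ha, hb, add_zero]
    | smul c a _ ha => rw [dotProduct_smul, ha, smul_zero]

theorem mem_rowSpan {M : Matrix (Fin r) (Fin n) ℝ} {v : Fin n → ℝ} :
    v ∈ rowSpan M ↔ ∃ c : Fin r → ℝ, v = c ᵥ* M := by
  rw [rowSpan, Submodule.mem_span_range_iff_exists_fun]
  refine exists_congr fun c => ?_
  rw [Matrix.vecMul_eq_sum, eq_comm]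
  rfl

theorem perp_perp (V : Submodule ℝ (Fin n → ℝ)) : perp (perp V) = V := by
  have key : ∀ V : Submodule ℝ (Fin n → ℝ),
      LinearMap.BilinForm.orthogonal (Matrix.toBilin' (1 : Matrix (Fin n) (Fin n) ℝ)) V =
        perp V := by
    intro V
    ext v
    rw [LinearMap.BilinForm.mem_orthogonal_iff]
    refine forall₂_congr fun w _ => ?_
    rw [Matrix.toBilin'_apply', one_mulVec, dotProduct_comm]
  have h := LinearMap.BilinForm.orthogonal_orthogonal
    (B := Matrix.toBilin' (1 : Matrix (Fin n) (Fin n) ℝ))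
    (LinearMap.BilinForm.nondegenerate_toBilin'_of_det_ne_zero' _ (by simp)) (by
      intro v w h
      rw [Matrix.toBilin'_apply', one_mulVec] at h ⊢
      rwa [dotProduct_comm]) V
  rwa [key, key] at h

theorem contraction_swap (M : Matrix (Fin (r + 2)) (Fin n) ℝ) (W : Matrix (Fin r) (Fin n) ℝ)
    (p q : Fin n) : contraction M W q p = -contraction M W p q := by
  rw [contraction_eq_sum, contraction_eq_sum, ← sum_neg_distrib]
  refine sum_congr rfl fun A _ => ?_
  rw [ordSign_swap, Finset.insert_comm, prod_congr rfl fun a _ => mul_comm _ _]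
  ring

theorem contraction_self (M : Matrix (Fin (r + 2)) (Fin n) ℝ) (W : Matrix (Fin r) (Fin n) ℝ)
    (p : Fin n) : contraction M W p p = 0 := by
  have := contraction_swap M W p p
  linarith

section Intersection

variable {M : Matrix (Fin (r + 2)) (Fin n) ℝ} {W : Matrix (Fin r) (Fin n) ℝ}

/-- Cramer's rule: an element of the intersection is determined by two of its coordinates. -/
theorem contraction_mul_apply {v : Fin n → ℝ} (hv : v ∈ rowSpan M ⊓ perp (rowSpan W))
    (p q a : Fin n) :
    contraction M W p q * v a = contraction M W a q * v p + contraction M W p a * v q := by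
  obtain ⟨hM, hW⟩ := hv
  obtain ⟨x, rfl⟩ := mem_rowSpan.1 hM
  rw [SetLike.mem_coe, mem_perp_rowSpan] at hW
  set B : Matrix (Fin (r + 2)) (Fin (r + 2)) ℝ :=
    Matrix.of (vecCons (Mᵀ p) (vecCons (Mᵀ q) (W * Mᵀ))) with hB
  have hcol : ∀ b, Mᵀ b ⬝ᵥ x = (x ᵥ* M) b := fun b => dotProduct_comm _ _
  have hBx : ∀ i : Fin r, (B *ᵥ x) i.succ.succ = 0 := by
    intro i
    rw [← hW i, dotProduct_comm, ← mulVec_transpose, dotProduct_mulVec]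
    rfl
  set y := cramer Bᵀ (Mᵀ a) with hy
  have hy0 : y 0 = contraction M W a q := by
    rw [hy, cramer_transpose_apply, contraction]
    congr 1
    ext i j
    refine Fin.cases ?_ (fun i => ?_) i
    · rw [updateRow_self]; rfl
    · rw [updateRow_ne (Fin.succ_ne_zero i)]; rfl
  have hy1 : y 1 = contraction M W p a := by
    rw [hy, cramer_transpose_apply, contraction]
    congr 1
    ext i j
    refine Fin.cases ?_ (fun i => ?_) i
    · rw [updateRow_ne (by simp)]; rfl
    · refine Fin.cases ?_ (fun i => ?_) i
      · exact congrFun (updateRow_self (M := B) (i := 1)) j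
      · rw [updateRow_ne (by simp [Fin.ext_iff])]; rfl
  have hmain : Bᵀ *ᵥ y = Bᵀ.det • Mᵀ a := mulVec_cramer _ _
  have h1 : (Bᵀ *ᵥ y) ⬝ᵥ x = y ⬝ᵥ (B *ᵥ x) := by
    rw [mulVec_transpose, dotProduct_mulVec]
  rw [hmain, det_transpose, smul_dotProduct, hcol, dotProduct, Fin.sum_univ_succ,
    Fin.sum_univ_succ, sum_eq_zero (fun i _ => by rw [hBx i, mul_zero]), add_zero] at h1
  have h2 : (B *ᵥ x) 0 = (x ᵥ* M) p := hcol p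
  have h3 : (B *ᵥ x) (Fin.succ 0) = (x ᵥ* M) q := hcol q
  rw [h2, h3, hy0] at h1
  rw [← hy1]
  exact h1

theorem contraction_mem (M : Matrix (Fin (r + 2)) (Fin n) ℝ) (W : Matrix (Fin r) (Fin n) ℝ)
    (q : Fin n) : (fun a => contraction M W a q) ∈ rowSpan M ⊓ perp (rowSpan W) := by
  let φ : (Fin (r + 2) → ℝ) →ₗ[ℝ] ℝ :=
    { toFun := fun v => (Matrix.detRowAlternating (n := Fin (r + 2)) (R := ℝ)).curryLeft v
        (vecCons (Mᵀ q) (W * Mᵀ))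
      map_add' := by intro v w; simp only [map_add, AlternatingMap.add_apply]
      map_smul' := by intro c v; simp only [map_smul, AlternatingMap.smul_apply, RingHom.id_apply] }
  have hφ : ∀ a, contraction M W a q = φ (Mᵀ a) := fun a => rfl
  refine ⟨?_, ?_⟩
  · rw [SetLike.mem_coe, mem_rowSpan]
    refine ⟨fun s => φ fun j => if s = j then 1 else 0, ?_⟩
    funext a
    rw [hφ, LinearMap.pi_apply_eq_sum_univ]
    simp only [vecMul, dotProduct, transpose_apply, smul_eq_mul]
    exact sum_congr rfl fun s _ => mul_comm _ _
  · rw [SetLike.mem_coe, mem_perp_rowSpan]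
    intro i
    have h : (W * Mᵀ) i = ∑ a, W i a • Mᵀ a := by
      funext s
      simp [Matrix.mul_apply]
    have h0 : φ ((W * Mᵀ) i) = 0 := by
      refine Matrix.det_zero_of_row_eq (i := 0) (j := i.succ.succ) (by simp [Fin.ext_iff]) ?_
      rfl
    rw [h, map_sum] at h0
    rw [← h0, dotProduct]
    refine sum_congr rfl fun a _ => ?_
    rw [map_smul, hφ, smul_eq_mul, mul_comm]

/-- The minor of a `2 × n` matrix on the columns `p`, `q`, in this order. -/
def minor2 (N : Matrix (Fin 2) (Fin n) ℝ) (p q : Fin n) : ℝ :=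
  N 0 p * N 1 q - N 0 q * N 1 p

theorem contraction_mul_contraction (p q a b : Fin n) :
    contraction M W p q * contraction M W a b =
      contraction M W a q * contraction M W p b - contraction M W b q * contraction M W p a := by
  have h := contraction_mul_apply (contraction_mem M W b) p q a
  rw [h, contraction_swap M W b q]
  ring

/-- The minors of a matrix that represents the intersection are proportional to the
contractions. -/
theorem exists_minor2_eq_mul_contraction {p q : Fin n} (hpq : contraction M W p q ≠ 0)
    {N : Matrix (Fin 2) (Fin n) ℝ} (hN : Represents N (rowSpan M ⊓ perp (rowSpan W))) :
    ∃ c : ℝ, c ≠ 0 ∧ ∀ a b, minor2 N a b = c * contraction M W a b := by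
  have hmem : ∀ i, N i ∈ rowSpan M ⊓ perp (rowSpan W) := by
    intro i
    rw [← hN.2]
    exact Submodule.subset_span ⟨i, rfl⟩
  have hrow : ∀ i a, contraction M W p q * N i a =
      contraction M W a q * N i p + contraction M W p a * N i q :=
    fun i a => contraction_mul_apply (hmem i) p q a
  have hli := Fintype.linearIndependent_iff.1 hN.1
  refine ⟨minor2 N p q / contraction M W p q, div_ne_zero ?_ hpq, ?_⟩
  · intro h0
    unfold minor2 at h0
    have key : ∀ s t : ℝ, s * N 0 p + t * N 1 p = 0 → s * N 0 q + t * N 1 q = 0 →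
        s = 0 ∧ t = 0 := by
      intro s t h1 h2
      have := hli ![s, t] (by
        funext a
        rw [Fin.sum_univ_two, Pi.add_apply, Pi.zero_apply]
        change s * N 0 a + t * N 1 a = 0
        apply mul_left_cancel₀ hpq
        linear_combination s * hrow 0 a + t * hrow 1 a + contraction M W a q * h1 +
          contraction M W p a * h2)
      exact ⟨this 0, this 1⟩
    obtain ⟨e1, e2⟩ := key (N 1 p) (-N 0 p) (by ring) (by linarith)
    obtain ⟨e3, e4⟩ := key (N 1 q) (-N 0 q) (by linarith) (by ring)
    have := (key 1 0 (by linarith) (by linarith)).1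
    norm_num at this
  · intro a b
    rw [div_mul_eq_mul_div, eq_div_iff hpq]
    apply mul_left_cancel₀ hpq
    have h := contraction_mul_contraction (M := M) (W := W) p q a b
    unfold minor2
    calc contraction M W p q * ((N 0 a * N 1 b - N 0 b * N 1 a) * contraction M W p q)
        = (contraction M W p q * N 0 a) * (contraction M W p q * N 1 b) -
          (contraction M W p q * N 0 b) * (contraction M W p q * N 1 a) := by ring
      _ = (N 0 p * N 1 q - N 0 q * N 1 p) * (contraction M W p q * contraction M W a b) := by
          rw [hrow 0 a, hrow 1 b, hrow 0 b, hrow 1 a, h]; ring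
      _ = _ := by ring

theorem exists_represents_minor2_eq {p q : Fin n} (hpq : contraction M W p q ≠ 0) :
    ∃ N : Matrix (Fin 2) (Fin n) ℝ, Represents N (rowSpan M ⊓ perp (rowSpan W)) ∧
      ∀ a b, minor2 N a b = contraction M W a b := by
  set D := contraction M W p q with hD
  let N : Matrix (Fin 2) (Fin n) ℝ :=
    ![fun a => D⁻¹ * contraction M W a q, fun a => contraction M W p a]
  have hN0 : ∀ a, N 0 a = D⁻¹ * contraction M W a q := fun a => rfl
  have hN1 : ∀ a, N 1 a = contraction M W p a := fun a => rfl
  have m0 : N 0 ∈ rowSpan M ⊓ perp (rowSpan W) :=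
    Submodule.smul_mem _ D⁻¹ (contraction_mem M W q)
  have m1 : N 1 ∈ rowSpan M ⊓ perp (rowSpan W) := by
    have : N 1 = (-1 : ℝ) • fun a => contraction M W a p := by
      funext a
      rw [hN1, Pi.smul_apply, contraction_swap, smul_eq_mul]
      ring
    rw [this]
    exact Submodule.smul_mem _ _ (contraction_mem M W p)
  refine ⟨N, ⟨?_, ?_⟩, ?_⟩
  · rw [Fintype.linearIndependent_iff]
    intro g hg
    have h : ∀ a, g 0 * N 0 a + g 1 * N 1 a = 0 := by
      intro a
      have := congrFun hg a
      rwa [Fin.sum_univ_two] at this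
    have h0 := h p
    have h1 := h q
    rw [hN0, hN1, contraction_self, mul_zero, add_zero, ← hD, inv_mul_cancel₀ hpq, mul_one] at h0
    rw [hN1, h0, zero_mul, zero_add, ← hD] at h1
    intro i
    fin_cases i
    · exact h0
    · exact (mul_eq_zero.1 h1).resolve_right hpq
  · apply le_antisymm
    · refine Submodule.span_le.2 ?_
      rintro _ ⟨i, rfl⟩
      fin_cases i
      · exact m0
      · exact m1
    · intro v hv
      rw [mem_rowSpan]
      refine ⟨![v p, D⁻¹ * v q], ?_⟩
      funext a
      have h := contraction_mul_apply hv p q a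
      rw [← hD] at h
      have : (![v p, D⁻¹ * v q] ᵥ* N) a = v p * N 0 a + D⁻¹ * v q * N 1 a := by
        simp [vecMul, dotProduct, Fin.sum_univ_two]
      rw [this, hN0, hN1]
      field_simp
      linarith
  · intro a b
    have h := contraction_mul_contraction (M := M) (W := W) p q a b
    rw [← hD] at h
    rw [minor2, hN0, hN0, hN1, hN1]
    field_simp
    linarith

end Intersection

/-! ### Minors of the orthogonal complement -/

/-- The sign of the permutation that lists `A` in increasing order, followed by the complement of
`A` in increasing order. -/
theorem prod_ordSign_sum {l m : ℕ} (g : Fin l ⊕ Fin m ≃ Fin n)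
    (h1 : StrictMono fun i => g (Sum.inl i)) (h2 : StrictMono fun i => g (Sum.inr i)) :
    (∏ i : Fin (l + m), ∏ j ∈ Ioi i, ordSign (g (finSumFinEquiv.symm i))
      (g (finSumFinEquiv.symm j))) =
      ∏ i, ∏ j, ordSign (g (Sum.inl i)) (g (Sum.inr j)) := by
  have e : ∀ i : Fin (l + m), (∏ j ∈ Ioi i, ordSign (g (finSumFinEquiv.symm i))
      (g (finSumFinEquiv.symm j))) = ∏ j, if i < j then ordSign (g (finSumFinEquiv.symm i))
      (g (finSumFinEquiv.symm j)) else 1 := by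
    intro i
    rw [← prod_filter]
    refine prod_congr ?_ fun _ _ => rfl
    ext j; simp
  rw [prod_congr rfl fun i _ => e i, Fin.prod_univ_add]
  have e1 : ∏ i : Fin m, ∏ j, (if Fin.natAdd l i < j then
      ordSign (g (finSumFinEquiv.symm (Fin.natAdd l i))) (g (finSumFinEquiv.symm j)) else 1) =
        1 := by
    refine prod_eq_one fun i _ => prod_eq_one fun j _ => ?_
    split_ifs with hij
    · refine Fin.addCases (fun j hij => ?_) (fun j hij => ?_) j hij
      · rw [Fin.lt_def, Fin.val_natAdd, Fin.val_castAdd] at hij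
        omega
      · rw [finSumFinEquiv_symm_apply_natAdd, finSumFinEquiv_symm_apply_natAdd]
        refine ordSign_of_lt (h2 ?_)
        rw [Fin.lt_def, Fin.val_natAdd, Fin.val_natAdd] at hij
        rw [Fin.lt_def]
        omega
    · rfl
  rw [e1, mul_one]
  refine prod_congr rfl fun i _ => ?_
  rw [Fin.prod_univ_add, prod_eq_one, one_mul]
  · refine prod_congr rfl fun j _ => ?_
    rw [if_pos, finSumFinEquiv_symm_apply_castAdd, finSumFinEquiv_symm_apply_natAdd]
    rw [Fin.lt_def, Fin.val_natAdd, Fin.val_castAdd]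
    omega
  · intro j _
    split_ifs with hij
    · rw [finSumFinEquiv_symm_apply_castAdd, finSumFinEquiv_symm_apply_castAdd]
      exact ordSign_of_lt (h1 hij)
    · rfl

theorem prod_ordSign_compl {A : Finset (Fin n)} (hA : A.card = r) :
    ∏ a ∈ A, ∏ b ∈ Aᶜ, ordSign a b =
      (∏ i : Fin r, (-1 : ℝ) ^ (i : ℕ)) * ∏ a ∈ A, (-1 : ℝ) ^ (a : ℕ) := by
  have h1 : ∀ a ∈ A, ∏ b ∈ Aᶜ, ordSign a b = (∏ b ∈ A.erase a, ordSign a b) * (-1) ^ (a : ℕ) := by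
    intro a ha
    have hd : Disjoint (A.erase a) Aᶜ :=
      disjoint_compl_right.mono_left (erase_subset _ _)
    have hu : univ.erase a = A.erase a ∪ Aᶜ := by
      ext b
      simp only [mem_erase, mem_univ, and_true, mem_union, mem_compl]
      by_cases hb : b = a
      · subst hb; simp [ha]
      · tauto
    have hsq : (∏ b ∈ A.erase a, ordSign a b) * ∏ b ∈ A.erase a, ordSign a b = 1 :=
      posSign_mul_self A a
    rw [← posSign_univ a, posSign, hu, prod_union hd, ← mul_assoc, hsq, one_mul]
  rw [prod_congr rfl h1, prod_mul_distrib]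
  congr 1
  rw [← prod_orderEmbOfFin hA]
  exact prod_congr rfl fun i _ => posSign_orderEmbOfFin hA i

theorem plucker_alt (M : Matrix (Fin r) (Fin n) ℝ) (I : Finset (Fin n)) :
    plucker (alt M) I = (∏ a ∈ I, (-1 : ℝ) ^ (a : ℕ)) * plucker M I := by
  unfold plucker
  split_ifs with h
  · rw [← prod_orderEmbOfFin h, ← det_mul_row]
    rfl
  · rw [mul_zero]

/-- Complementary minors of orthogonal complements agree up to the signs of `alt` and a common
factor. -/
theorem exists_plucker_eq_mul_plucker_alt_compl {l m : ℕ} (hn : l + m = n)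
    {N : Matrix (Fin m) (Fin n) ℝ} {W : Matrix (Fin l) (Fin n) ℝ}
    (hN : LinearIndependent ℝ N.row) (hW : LinearIndependent ℝ W.row) (hNW : N * Wᵀ = 0) :
    ∃ c : ℝ, c ≠ 0 ∧ ∀ A : Finset (Fin n), A.card = l →
      plucker W A = c * plucker (alt N) Aᶜ := by
  subst hn
  have hWN : W * Nᵀ = 0 := by
    have := congrArg transpose hNW
    rwa [transpose_mul, transpose_transpose, transpose_zero] at this
  set Y : Matrix (Fin l ⊕ Fin m) (Fin (l + m)) ℝ := fromRows W N with hY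
  set Y' : Matrix (Fin (l + m)) (Fin (l + m)) ℝ := Y.submatrix finSumFinEquiv.symm id with hY'
  have hYt : Yᵀ = fromCols Wᵀ Nᵀ := transpose_fromRows _ _
  have hdN := det_mul_transpose_self_ne_zero hN
  have hdW := det_mul_transpose_self_ne_zero hW
  have hYY : (Y * Yᵀ).det = (W * Wᵀ).det * (N * Nᵀ).det := by
    rw [hYt, hY, fromRows_mul_fromCols, hWN, hNW, det_fromBlocks_zero₁₂]
  have hY'd : Y'.det ≠ 0 := by
    intro h0
    have : (Y * Yᵀ).submatrix finSumFinEquiv.symm finSumFinEquiv.symm = Y' * Y'ᵀ := rfl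
    have h2 := det_submatrix_equiv_self finSumFinEquiv.symm (Y * Yᵀ)
    rw [this, det_mul, h0, zero_mul, hYY] at h2
    exact mul_ne_zero hdW hdN h2.symm
  have hpY' : plucker Y' univ = Y'.det := by
    have := det_submatrix_eq_sign_mul_plucker Y' (g := id) Function.injective_id
    rw [submatrix_id_id, image_id, prod_eq_one, one_mul] at this
    · exact this.symm
    · exact fun i _ => prod_eq_one fun j hj => ordSign_of_lt (mem_Ioi.1 hj)
  refine ⟨(N * Nᵀ).det⁻¹ * ((∏ i : Fin l, (-1 : ℝ) ^ (i : ℕ)) * Y'.det *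
    ∏ a : Fin (l + m), (-1 : ℝ) ^ (a : ℕ)), ?_, ?_⟩
  · refine mul_ne_zero (inv_ne_zero hdN) (mul_ne_zero (mul_ne_zero ?_ hY'd) ?_)
    · rw [prod_ne_zero_iff]
      exact fun i _ => pow_ne_zero _ (by norm_num)
    · rw [prod_ne_zero_iff]
      exact fun a _ => pow_ne_zero _ (by norm_num)
  intro A hA
  have hA' : Aᶜ.card = m := by rw [card_compl, hA, Fintype.card_fin]; omega
  set g := finSumEquivOfFinset hA hA' with hg
  have hginj : Function.Injective (fun i => g (finSumFinEquiv.symm i)) :=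
    g.injective.comp finSumFinEquiv.symm.injective
  -- the rows of `N`, completed by the coordinate vectors of the elements of `A`
  set Z : Matrix (Fin l ⊕ Fin m) (Fin (l + m)) ℝ :=
    fromRows (Matrix.of fun j b => if b = A.orderEmbOfFin hA j then 1 else 0) N with hZ
  have hZY : (Z * Yᵀ).det = plucker W A * (N * Nᵀ).det := by
    rw [hYt, hZ, fromRows_mul_fromCols, hNW, det_fromBlocks_zero₂₁, plucker, dif_pos hA,
      ← det_transpose (W.submatrix _ _)]
    congr 2
    ext i j
    simp [Matrix.mul_apply]
  have hZg : (Z.submatrix id g).det = plucker N Aᶜ := by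
    have : Z.submatrix id g = fromBlocks 1 0 (N.submatrix id (A.orderEmbOfFin hA))
        (N.submatrix id (Aᶜ.orderEmbOfFin hA')) := by
      ext i j
      rcases i with i | i <;> rcases j with j | j
      · simp [hZ, hg, Matrix.one_apply, eq_comm]
      · have : Aᶜ.orderEmbOfFin hA' j ≠ A.orderEmbOfFin hA i := by
          intro h
          have h1 := orderEmbOfFin_mem Aᶜ hA' j
          rw [h, mem_compl] at h1
          exact h1 (orderEmbOfFin_mem _ _ _)
        simp [hZ, hg, this]
      · simp [hZ, hg]
      · simp [hZ, hg]
    rw [this, det_fromBlocks_zero₁₂, det_one, one_mul, plucker, dif_pos hA']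
  have hYg : (Y.submatrix id g).det =
      (∏ i : Fin l, (-1 : ℝ) ^ (i : ℕ)) * (∏ a ∈ A, (-1 : ℝ) ^ (a : ℕ)) * Y'.det := by
    have h1 : (Y.submatrix id g).submatrix finSumFinEquiv.symm finSumFinEquiv.symm =
        Y'.submatrix id (fun i => g (finSumFinEquiv.symm i)) := rfl
    have h2 := det_submatrix_equiv_self finSumFinEquiv.symm (Y.submatrix id g)
    rw [h1, det_submatrix_eq_sign_mul_plucker Y' hginj] at h2
    have h3 : univ.image (fun i => g (finSumFinEquiv.symm i)) = univ :=
      image_univ_of_surjective (g.surjective.comp finSumFinEquiv.symm.surjective)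
    rw [← h2, h3, hpY', prod_ordSign_sum g (A.orderEmbOfFin hA).strictMono
      (Aᶜ.orderEmbOfFin hA').strictMono, ← prod_ordSign_compl hA, ← prod_orderEmbOfFin hA]
    congr 1
    refine prod_congr rfl fun i _ => ?_
    rw [← prod_orderEmbOfFin hA']
    rfl
  have hprod : Z * Yᵀ = Z.submatrix id g * (Y.submatrix id g)ᵀ := by
    rw [transpose_submatrix, submatrix_mul_equiv, submatrix_id_id]
  rw [hprod, det_mul, det_transpose, hZg, hYg] at hZY
  rw [plucker_alt, ← prod_mul_prod_compl A]
  field_simp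
  have hsq : (∏ a ∈ Aᶜ, (-1 : ℝ) ^ (a : ℕ)) * ∏ a ∈ Aᶜ, (-1 : ℝ) ^ (a : ℕ) = 1 := by
    rw [← prod_mul_distrib]
    refine prod_eq_one fun a _ => ?_
    rw [← mul_pow]; norm_num
  linear_combination -hZY - plucker N Aᶜ * (∏ i : Fin l, (-1 : ℝ) ^ (i : ℕ)) *
    (∏ a ∈ A, (-1 : ℝ) ^ (a : ℕ)) * Y'.det * hsq

/-! ### Non-vanishing and signs of the contractions -/

theorem IsTotallyNonneg.plucker_mul_nonneg {M : Matrix (Fin r) (Fin n) ℝ}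
    (hM : IsTotallyNonneg M) (A B : Finset (Fin n)) : 0 ≤ plucker M A * plucker M B := by
  by_cases hA : A.card = r
  · by_cases hB : B.card = r
    · exact hM.2 A B hA hB
    · rw [plucker_eq_zero_of_card hB, mul_zero]
  · rw [plucker_eq_zero_of_card hA, zero_mul]

theorem contraction_ne_zero {M : Matrix (Fin (r + 2)) (Fin n) ℝ} {W : Matrix (Fin r) (Fin n) ℝ}
    (hM : ∀ A B, 0 ≤ plucker M A * plucker M B) (hW : ∀ A B, 0 ≤ plucker W A * plucker W B)
    {p q : Fin n} (hpq : p ≠ q) {σ : ℝ}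
    (hσ : ∀ A, plucker W A ≠ 0 → plucker M (insert p (insert q A)) ≠ 0 → p ∉ A → q ∉ A →
      ∏ a ∈ A, ordSign p a * ordSign q a = σ)
    {A₀ : Finset (Fin n)} (hp : p ∉ A₀) (hq : q ∉ A₀) (hWA : plucker W A₀ ≠ 0)
    (hMA : plucker M (insert p (insert q A₀)) ≠ 0) : contraction M W p q ≠ 0 := by
  set t : Finset (Fin n) → ℝ := fun A => plucker W A *
      (ordSign p q * (∏ a ∈ A, ordSign p a * ordSign q a) * plucker M (insert p (insert q A)))
    with ht
  have hord : ∀ {a b : Fin n}, a ≠ b → ordSign a b ≠ 0 := by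
    intro a b hab h0
    have := ordSign_mul_self hab
    rw [h0] at this
    norm_num at this
  have hσ0 : σ ≠ 0 := by
    rw [← hσ A₀ hWA hMA hp hq, prod_ne_zero_iff]
    exact fun a ha => mul_ne_zero (hord fun h => hp (h ▸ ha)) (hord fun h => hq (h ▸ ha))
  have ht0 : t A₀ = plucker W A₀ * (ordSign p q * σ * plucker M (insert p (insert q A₀))) := by
    simp only [ht]
    rw [hσ A₀ hWA hMA hp hq]
  have hne : t A₀ ≠ 0 := by
    rw [ht0]
    exact mul_ne_zero hWA (mul_ne_zero (mul_ne_zero (hord hpq) hσ0) hMA)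
  have hnn : ∀ A, 0 ≤ t A * t A₀ := by
    intro A
    by_cases h : t A = 0
    · rw [h, zero_mul]
    · have h1 : plucker W A ≠ 0 := left_ne_zero_of_mul h
      have h2 := right_ne_zero_of_mul h
      have h3 : plucker M (insert p (insert q A)) ≠ 0 := right_ne_zero_of_mul h2
      have h4 := right_ne_zero_of_mul (left_ne_zero_of_mul h2)
      rw [prod_ne_zero_iff] at h4
      have hpA : p ∉ A := fun h => h4 p h (by simp)
      have hqA : q ∉ A := fun h => h4 q h (by simp)
      have : t A * t A₀ = (plucker W A * plucker W A₀) *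
          (plucker M (insert p (insert q A)) * plucker M (insert p (insert q A₀))) *
          (ordSign p q * σ) ^ 2 := by
        rw [ht0]
        simp only [ht]
        rw [hσ A h1 h3 hpA hqA]
        ring
      rw [this]
      exact mul_nonneg (mul_nonneg (hW _ _) (hM _ _)) (sq_nonneg _)
  intro h0
  have hsum : ∑ A, t A * t A₀ = 0 := by
    rw [← sum_mul, ← contraction_eq_sum, h0, zero_mul]
  have := (sum_eq_zero_iff_of_nonneg fun A _ => hnn A).1 hsum A₀ (mem_univ _)
  exact mul_ne_zero hne hne this

theorem exists_minimal_pair {Q : Fin n → Fin n → Prop} (h : ∃ p q, p < q ∧ Q p q) :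
    ∃ p q, p < q ∧ Q p q ∧ ∀ c, p < c → c < q → ¬Q p c := by
  classical
  obtain ⟨p₀, q₀, h₀⟩ := h
  obtain ⟨⟨p, q⟩, hm, hmin⟩ := exists_min_image
    (univ.filter fun a : Fin n × Fin n => a.1 < a.2 ∧ Q a.1 a.2)
    (fun a => (a.2 : ℕ) - (a.1 : ℕ)) ⟨(p₀, q₀), by simpa using h₀⟩
  simp only [mem_filter, mem_univ, true_and] at hm
  refine ⟨p, q, hm.1, hm.2, fun c hpc hcq hQ => ?_⟩
  have := hmin (p, c) (by simp [hpc, hQ])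
  simp only [Fin.lt_def] at *
  omega

/-- Choose `p`, `q` as close as possible among the pairs of columns that lie in a common basis of
columns of `M`. Then no basis through `p` and `q` contains a column in between, so that no signs
occur in the expansion of the contraction. -/
theorem exists_contraction_ne_zero_of_pos {M : Matrix (Fin (r + 2)) (Fin n) ℝ}
    {W : Matrix (Fin r) (Fin n) ℝ} (hM : IsTotallyNonneg M)
    (hW : ∀ A B, 0 ≤ plucker W A * plucker W B)
    (hW' : ∀ A : Finset (Fin n), A.card = r → plucker W A ≠ 0) :
    ∃ p q, contraction M W p q ≠ 0 := by
  obtain ⟨I, hI⟩ := exists_plucker_ne_zero hM.1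
  have hIc : I.card = r + 2 := by
    by_contra h
    exact hI (plucker_eq_zero_of_card h)
  obtain ⟨p₀, hp₀, q₀, hq₀, hne⟩ := one_lt_card.1 (show 1 < I.card by omega)
  obtain ⟨p, q, hpq, ⟨K, hK, hpK, hqK⟩, hmin⟩ := exists_minimal_pair
    (Q := fun p q => ∃ K, plucker M K ≠ 0 ∧ p ∈ K ∧ q ∈ K) (by
      rcases lt_or_gt_of_ne hne with h | h
      · exact ⟨p₀, q₀, h, I, hI, hp₀, hq₀⟩
      · exact ⟨q₀, p₀, h, I, hI, hq₀, hp₀⟩)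
  have hKc : K.card = r + 2 := by
    by_contra h
    exact hK (plucker_eq_zero_of_card h)
  have hqK' : q ∈ K.erase p := mem_erase.2 ⟨hpq.ne', hqK⟩
  have hins : insert p (insert q ((K.erase p).erase q)) = K := by
    rw [insert_erase hqK', insert_erase hpK]
  refine ⟨p, q, contraction_ne_zero hM.plucker_mul_nonneg hW hpq.ne (σ := 1)
    (A₀ := (K.erase p).erase q) ?_ (by simp) (by simp) (hW' _ ?_) (by rwa [hins])⟩
  · intro A _ hMA hpA hqA
    refine prod_eq_one fun a ha => ?_
    by_cases h : p < a ∧ a < q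
    · exact absurd ⟨_, hMA, by simp, by simp [ha]⟩ (hmin a h.1 h.2)
    · refine ordSign_mul_ordSign_of_not_between hpq ?_
      by_contra hc
      push Not at hc
      exact h ⟨lt_of_le_of_ne hc.1 fun h => hpA (h ▸ ha), lt_of_le_of_ne hc.2 fun h => hqA (h ▸ ha)⟩
  · rw [card_erase_of_mem hqK', card_erase_of_mem hpK, hKc]
    rfl

/-- Choose `p`, `q` as close as possible among the pairs of columns that are both avoided by some
basis of columns of `W`. Then every basis that avoids them contains all columns in between, so that
all terms in the expansion of the contraction carry the same sign. -/
theorem exists_contraction_ne_zero_of_pos' {M : Matrix (Fin (r + 2)) (Fin n) ℝ}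
    {W : Matrix (Fin r) (Fin n) ℝ} (hW : IsTotallyNonneg W) (hM : IsTotallyPos M)
    (hn : r + 2 ≤ n) : ∃ p q, contraction M W p q ≠ 0 := by
  obtain ⟨I, hI⟩ := exists_plucker_ne_zero hW.1
  have hIc : I.card = r := by
    by_contra h
    exact hI (plucker_eq_zero_of_card h)
  obtain ⟨p₀, hp₀, q₀, hq₀, hne⟩ := one_lt_card.1 (show 1 < Iᶜ.card by
    rw [card_compl, hIc, Fintype.card_fin]; omega)
  rw [mem_compl] at hp₀ hq₀
  obtain ⟨p, q, hpq, ⟨K, hK, hpK, hqK⟩, hmin⟩ := exists_minimal_pair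
    (Q := fun p q => ∃ K, plucker W K ≠ 0 ∧ p ∉ K ∧ q ∉ K) (by
      rcases lt_or_gt_of_ne hne with h | h
      · exact ⟨p₀, q₀, h, I, hI, hp₀, hq₀⟩
      · exact ⟨q₀, p₀, h, I, hI, hq₀, hp₀⟩)
  have hKc : K.card = r := by
    by_contra h
    exact hK (plucker_eq_zero_of_card h)
  refine ⟨p, q, contraction_ne_zero hM.1.plucker_mul_nonneg hW.plucker_mul_nonneg hpq.ne
    (σ := ∏ a ∈ Ioo p q, ordSign p a * ordSign q a) ?_ hpK hqK hK (hM.2 _ ?_)⟩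
  · intro A hA _ hpA hqA
    symm
    refine prod_subset ?_ ?_
    · intro a ha
      rw [mem_Ioo] at ha
      by_contra h
      exact hmin a ha.1 ha.2 ⟨A, hA, hpA, h⟩
    · intro a ha h
      rw [mem_Ioo] at h
      refine ordSign_mul_ordSign_of_not_between hpq ?_
      by_contra hc
      push Not at hc
      exact h ⟨lt_of_le_of_ne hc.1 fun h => hpA (h ▸ ha), lt_of_le_of_ne hc.2 fun h => hqA (h ▸ ha)⟩
  · rw [card_insert_of_notMem, card_insert_of_notMem hqK, hKc]
    simp [hpq.ne, hpK]

theorem mul_contraction_nonneg {M : Matrix (Fin (r + 2)) (Fin n) ℝ} {W : Matrix (Fin r) (Fin n) ℝ}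
    {s : ℝ} {p q : Fin n} (hs : ∀ A B, 0 ≤ s * (plucker W A * plucker M B)) (hpq : p < q)
    {σ : ℝ} (hσ : ∀ A : Finset (Fin n), A.card = r → p ∉ A → q ∉ A →
      ∏ a ∈ A, ordSign p a * ordSign q a = σ) (hσ1 : σ * σ = 1) :
    0 ≤ s * (σ * contraction M W p q) := by
  rw [contraction_eq_sum, mul_sum, mul_sum]
  refine sum_nonneg fun A _ => ?_
  by_cases hA : A.card = r
  · by_cases hpA : p ∈ A
    · rw [prod_eq_zero hpA (by simp)]; simp
    by_cases hqA : q ∈ A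
    · rw [prod_eq_zero hqA (by simp)]; simp
    rw [hσ A hA hpA hqA, ordSign_of_lt hpq]
    have : s * (σ * (plucker W A * (1 * σ * plucker M (insert p (insert q A))))) =
        (σ * σ) * (s * (plucker W A * plucker M (insert p (insert q A)))) := by ring
    rw [this, hσ1, one_mul]
    exact hs _ _
  · rw [plucker_eq_zero_of_card hA]; simp

/-! ### Brackets and Mandelstam variables over the integers -/

/-- The column label of an integer, as an element of `Fin n`. -/
def colIndex (hn : 0 < n) (m : ℤ) : Fin n :=
  ⟨((m - 1) % (n : ℤ)).toNat, by
    have h1 := Int.emod_nonneg (m - 1) (b := (n : ℤ)) (by omega)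
    have h2 := Int.emod_lt_of_pos (m - 1) (b := (n : ℤ)) (by omega)
    omega⟩

theorem coe_colIndex (hn : 0 < n) (m : ℤ) : ((colIndex hn m : ℕ) : ℤ) = (m - 1) % (n : ℤ) :=
  Int.toNat_of_nonneg (Int.emod_nonneg (m - 1) (by omega))

theorem bracket_eq (k : ℕ) (hn : 0 < n) (N : Matrix (Fin 2) (Fin n) ℝ) (p q : ℤ) :
    bracket k hn N p q = (-1 : ℝ) ^ (((k : ℤ) - 1) * ((p - 1) / (n : ℤ))) *
      (-1 : ℝ) ^ (((k : ℤ) - 1) * ((q - 1) / (n : ℤ))) *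
      minor2 N (colIndex hn p) (colIndex hn q) := by
  unfold bracket extCol minor2 colIndex
  ring

theorem neg_one_zpow_mul_self (z : ℤ) : (-1 : ℝ) ^ z * (-1 : ℝ) ^ z = 1 := by
  rw [← mul_zpow]; norm_num

theorem bracket_mul_bracket (k : ℕ) (hn : 0 < n) (N N' : Matrix (Fin 2) (Fin n) ℝ) (p q : ℤ) :
    bracket k hn N p q * bracket k hn N' p q =
      minor2 N (colIndex hn p) (colIndex hn q) * minor2 N' (colIndex hn p) (colIndex hn q) := by
  rw [bracket_eq, bracket_eq]
  have h1 := neg_one_zpow_mul_self (((k : ℤ) - 1) * ((p - 1) / (n : ℤ)))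
  have h2 := neg_one_zpow_mul_self (((k : ℤ) - 1) * ((q - 1) / (n : ℤ)))
  set x := (-1 : ℝ) ^ (((k : ℤ) - 1) * ((p - 1) / (n : ℤ)))
  set y := (-1 : ℝ) ^ (((k : ℤ) - 1) * ((q - 1) / (n : ℤ)))
  linear_combination (minor2 N (colIndex hn p) (colIndex hn q) *
    minor2 N' (colIndex hn p) (colIndex hn q)) * (y * y * h1 + h2)

/-- Consecutive brackets are minors of adjacent columns, or the twisted minor of the last and the
first column. -/
theorem bracket_succ_eq (k : ℕ) (hn : 0 < n) (N : Matrix (Fin 2) (Fin n) ℝ) (p : ℤ) :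
    (∃ a b : Fin n, (b : ℕ) = a + 1 ∧ bracket k hn N p (p + 1) = minor2 N a b) ∨
    (∃ a b : Fin n, (a : ℕ) = 0 ∧ (b : ℕ) = n - 1 ∧
      bracket k hn N p (p + 1) = (-1) ^ k * minor2 N a b) := by
  have hn' : (n : ℤ) ≠ 0 := by omega
  have e1 := Int.emod_nonneg (p - 1) hn'
  have e2 := Int.emod_lt_of_pos (p - 1) (b := (n : ℤ)) (by omega)
  have e3 := Int.mul_ediv_add_emod (p - 1) n
  have ha := coe_colIndex hn p
  have hb := coe_colIndex hn (p + 1)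
  by_cases hlast : (p - 1) % (n : ℤ) + 1 < n
  · left
    have hd : (p + 1 - 1) / (n : ℤ) = (p - 1) / n ∧ (p + 1 - 1) % (n : ℤ) = (p - 1) % n + 1 := by
      rw [Int.ediv_emod_unique (by omega)]
      exact ⟨by linarith, by omega, hlast⟩
    refine ⟨colIndex hn p, colIndex hn (p + 1), by rw [hd.2] at hb; omega, ?_⟩
    rw [bracket_eq, hd.1, neg_one_zpow_mul_self, one_mul]
  · right
    have hd : (p + 1 - 1) / (n : ℤ) = (p - 1) / n + 1 ∧ (p + 1 - 1) % (n : ℤ) = 0 := by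
      rw [Int.ediv_emod_unique (by omega)]
      refine ⟨?_, by omega, by omega⟩
      rw [mul_add, mul_one]
      linarith [show (p - 1) % (n : ℤ) = n - 1 by omega]
    refine ⟨colIndex hn (p + 1), colIndex hn p, by rw [hd.2] at hb; omega, by omega, ?_⟩
    rw [bracket_eq, hd.1, mul_add, mul_one, zpow_add₀ (by norm_num), ← mul_assoc,
      neg_one_zpow_mul_self, one_mul, zpow_sub_one₀ (by norm_num), zpow_natCast]
    have : minor2 N (colIndex hn p) (colIndex hn (p + 1)) =
        -minor2 N (colIndex hn (p + 1)) (colIndex hn p) := by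
      unfold minor2; ring
    rw [this, inv_neg_one]
    ring

theorem inInterval_iff (hn : 0 < n) {i j : ℤ} {a : Fin n} :
    InInterval i j a ↔ ∃ m ∈ Ioc i j, colIndex hn m = a := by
  unfold InInterval
  refine exists_congr fun m => ?_
  rw [mem_Ioc, and_assoc]
  refine and_congr_right fun _ => and_congr_right fun _ => ?_
  have ha : ((a : ℕ) : ℤ) % n = a := Int.emod_eq_of_lt (by omega) (by omega)
  rw [Fin.ext_iff, ← Int.natCast_inj, coe_colIndex, ← ha]
  constructor
  · intro h
    have := h.sub_right 1
    rw [add_sub_cancel_right] at this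
    exact this.trans (Int.mod_modEq _ _)
  · intro h
    have : m - 1 ≡ (a : ℕ) [ZMOD n] := h
    have := this.add_right 1
    rwa [sub_add_cancel, ← ha] at this

theorem eq_add_of_modEq {m m' d : ℤ} (h : m' ≡ m + d [ZMOD n]) (h1 : m < m') (h2 : m' < m + n)
    (h3 : 0 ≤ d) (h4 : d < n) : m' = m + d := by
  have := Int.eq_zero_of_abs_lt_dvd h.dvd (by rw [abs_lt]; constructor <;> linarith)
  linarith

theorem isCyclicInterval_inInterval {i j : ℤ} (hij : j - i ≤ n) :
    IsCyclicInterval (InInterval (n := n) i j) := by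
  have key : ∀ {a b c d : Fin n}, a < b → b < c → c < d ∨ d < a → InInterval i j a →
      InInterval i j c → InInterval i j b ∨ InInterval i j d := by
    rintro a b c d hab hbc hd ⟨m, hm1, hm2, hm3⟩ ⟨m', hm1', hm2', hm3'⟩
    have := d.2
    have hac : m' - m ≡ c - a [ZMOD n] := by
      have := hm3'.sub hm3
      rwa [add_sub_add_right_eq_sub] at this
    rw [Fin.lt_def] at hab hbc
    rw [Fin.lt_def, Fin.lt_def] at hd
    rcases lt_trichotomy m m' with h | h | h
    · left
      have e := eq_add_of_modEq (n := n) (d := c - a) (m := m) (m' := m')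
        (by have := hac.add_left m; rwa [add_sub_cancel] at this) h (by linarith) (by omega)
        (by omega)
      refine ⟨m + (b - a), by omega, by omega, ?_⟩
      have := hm3.add_right ((b : ℤ) - a)
      rwa [show (a : ℤ) + 1 + (b - a) = b + 1 by ring] at this
    · exfalso
      rw [h, sub_self] at hac
      have := Int.eq_zero_of_abs_lt_dvd hac.dvd (by rw [abs_lt]; constructor <;> omega)
      omega
    · right
      have e := eq_add_of_modEq (n := n) (d := n + a - c) (m := m') (m' := m)
        (by
          have h1 := hac.symm.sub_left (m' : ℤ)
          have h2 : m' - (m' - m) = m := by ring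
          rw [h2] at h1
          refine (h1.symm.trans ?_)
          rw [Int.modEq_iff_dvd]
          exact ⟨1, by ring⟩) h (by linarith) (by omega) (by omega)
      rcases hd with hd | hd
      · refine ⟨m' + (d - c), by omega, by omega, ?_⟩
        have := hm3'.add_right ((d : ℤ) - c)
        rwa [show (c : ℤ) + 1 + (d - c) = d + 1 by ring] at this
      · refine ⟨m' + (n + d - c), by omega, by omega, ?_⟩
        have := hm3'.add_right ((n : ℤ) + d - c)
        refine this.trans ?_
        rw [Int.modEq_iff_dvd]
        exact ⟨-1, by ring⟩
  intro a b c d hab hbc hcd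
  constructor
  · rintro ⟨h1, h2, h3, h4⟩
    exact (key hab hbc (Or.inl hcd) h1 h3).elim h2 h4
  · rintro ⟨h1, h2, h3, h4⟩
    exact (key hbc hcd (Or.inr hab) h2 h4).elim h3 h1

open Classical in
theorem two_mul_mandelstam (k : ℕ) (hn : 0 < n) (N N' : Matrix (Fin 2) (Fin n) ℝ) {i j : ℤ}
    (hij : j - i ≤ n) :
    2 * mandelstam k hn N N' i j =
      ∑ a : Fin n with InInterval i j a, ∑ b : Fin n with InInterval i j b,
        minor2 N a b * minor2 N' a b := by
  set f : Fin n → Fin n → ℝ := fun a b => minor2 N a b * minor2 N' a b with hf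
  have hfs : ∀ a b, f a b = f b a := by
    intro a b
    simp only [hf, minor2]
    ring
  have hf0 : ∀ a, f a a = 0 := by
    intro a
    simp only [hf, minor2]
    ring
  have hinj : Set.InjOn (colIndex hn) (Ioc i j : Finset ℤ) := by
    intro p hp q hq h
    rw [mem_coe, mem_Ioc] at hp hq
    rw [Fin.ext_iff, ← Int.natCast_inj, coe_colIndex, coe_colIndex] at h
    have := Int.eq_zero_of_abs_lt_dvd (Int.ModEq.dvd h) (by rw [abs_lt]; constructor <;> omega)
    linarith
  have himg : (univ.filter fun a : Fin n => InInterval i j a) = (Ioc i j).image (colIndex hn) := by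
    ext a
    rw [mem_filter, inInterval_iff hn, mem_image]
    simp
  have hfull : ∑ a : Fin n with InInterval i j a, ∑ b : Fin n with InInterval i j b, f a b =
      ∑ p ∈ Ioc i j, ∑ q ∈ Ioc i j, f (colIndex hn p) (colIndex hn q) := by
    rw [himg, sum_image hinj]
    exact sum_congr rfl fun p _ => sum_image hinj
  have hm : mandelstam k hn N N' i j =
      ∑ p ∈ Ioc i j, ∑ q ∈ Ioc i j with p < q, f (colIndex hn p) (colIndex hn q) := by
    unfold mandelstam
    refine sum_congr rfl fun p hp => ?_
    rw [mem_Ioc] at hp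
    have : Ioc p j = (Ioc i j).filter (fun q => p < q) := by
      ext q
      simp only [mem_filter, mem_Ioc]
      constructor
      · exact fun h => ⟨⟨hp.1.trans h.1, h.2⟩, h.1⟩
      · exact fun h => ⟨h.2, h.1.2⟩
    rw [this]
    exact sum_congr rfl fun q _ => bracket_mul_bracket k hn N N' p q
  have hm' : mandelstam k hn N N' i j =
      ∑ p ∈ Ioc i j, ∑ q ∈ Ioc i j with q < p, f (colIndex hn p) (colIndex hn q) := by
    rw [hm]
    simp only [sum_filter]
    rw [sum_comm]
    refine sum_congr rfl fun p _ => sum_congr rfl fun q _ => ?_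
    rw [hfs]
  rw [hfull, two_mul]
  nth_rewrite 1 [hm]
  rw [hm', ← sum_add_distrib]
  refine sum_congr rfl fun p _ => ?_
  simp only [sum_filter]
  rw [← sum_add_distrib]
  refine sum_congr rfl fun q _ => ?_
  rcases lt_trichotomy p q with h | h | h
  · rw [if_pos h, if_neg h.not_gt, add_zero]
  · subst h
    simp [hf0]
  · rw [if_pos h, if_neg h.not_gt, zero_add]

/-! ### The expansion into immanants and the cancellation -/

namespace PartialMatching

variable {k : ℕ} {x : PartialMatching k n}

theorem Compatible.card {A B : Finset (Fin n)} (h : x.Compatible A B) :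
    A.card = k ∧ B.card = k := by
  have hc := compatible_iff.1 h
  have h1 := hc.2.2.card
  have h2 := card_image_of_injective (A \ B) x.τ_injective
  rw [h.2.2] at h2
  rw [hc.1] at h1
  have h3 := card_sdiff_add_card_inter A B
  have h4 := card_sdiff_add_card_inter B A
  rw [inter_comm] at h4
  omega

variable (x) in
/-- The contribution of `p`, `q` in a transversal `U` to the coefficient of the immanant of `x`. -/
noncomputable def term (w u : Finset (Fin n) → ℝ) (t : Fin n × Fin n × Finset (Fin n)) : ℝ :=
  -(posSign x.S t.1 * posSign x.S t.2.1) * w (x.T ∪ (t.2.2.erase t.1).erase t.2.1) *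
    u (x.T ∪ (x.S \ t.2.2) ∪ {t.1, t.2.1})

variable (x) in
open Classical in
/-- The transversals `U` of `x` with two distinct distinguished elements that lie in `I`. -/
noncomputable def pointed (I : Fin n → Prop) : Finset (Fin n × Fin n × Finset (Fin n)) :=
  univ.filter fun t => t.1 ≠ t.2.1 ∧ I t.1 ∧ I t.2.1 ∧ t.1 ∈ t.2.2 ∧ t.2.1 ∈ t.2.2 ∧
    x.IsTransversal t.2.2

theorem mem_pointed {I : Fin n → Prop} {p q : Fin n} {U : Finset (Fin n)} :
    (p, q, U) ∈ x.pointed I ↔ p ≠ q ∧ I p ∧ I q ∧ p ∈ U ∧ q ∈ U ∧ x.IsTransversal U := by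
  simp [pointed]

theorem IsTransversal.flip {U : Finset (Fin n)} {q : Fin n} (hU : x.IsTransversal U)
    (hq : q ∈ U) : x.IsTransversal (insert (x.τ q) (U.erase q)) := by
  have hqS := hU.1 hq
  have hne := x.mem_S.1 hqS
  refine ⟨insert_subset (x.τ_mem_S hqS) ((erase_subset _ _).trans hU.1), fun l hl => ?_⟩
  have h := hU.2 l hl
  by_cases h1 : l = q
  · subst h1
    simp [hne.symm]
  by_cases h2 : l = x.τ q
  · subst h2
    simp [x.involutive, hne.symm]
  · have h3 : x.τ l ≠ x.τ q := fun h => h1 (x.τ_injective h)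
    have h4 : x.τ l ≠ q := fun h => h2 (x.τ_eq_iff.1 h)
    simpa [h1, h2, h3, h4] using h

theorem term_swap (w u : Finset (Fin n) → ℝ) (p q : Fin n) (U : Finset (Fin n)) :
    x.term w u (q, p, U) = x.term w u (p, q, U) := by
  simp only [term]
  rw [erase_right_comm, pair_comm, mul_comm (posSign x.S q)]

theorem term_flip (w u : Finset (Fin n) → ℝ) {p q : Fin n} {U : Finset (Fin n)}
    (hU : x.IsTransversal U) (hp : p ∈ U) (hq : q ∈ U) :
    x.term w u (p, x.τ q, insert (x.τ q) (U.erase q)) = -x.term w u (p, q, U) := by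
  have hqS := hU.1 hq
  have hqU : x.τ q ∉ U := fun h => ((hU.2 q hqS).1 h) hq
  have hpq : p ≠ x.τ q := fun h => hqU (h ▸ hp)
  have e1 : ((insert (x.τ q) (U.erase q)).erase p).erase (x.τ q) = (U.erase p).erase q := by
    ext l
    simp only [mem_erase, mem_insert]
    constructor
    · rintro ⟨h1, h2, h3 | h3⟩
      · exact absurd h3 h1
      · exact ⟨h3.1, h2, h3.2⟩
    · rintro ⟨h1, h2, h3⟩
      exact ⟨fun h => hqU (h ▸ h3), h2, Or.inr ⟨h1, h3⟩⟩
  have e2 : x.T ∪ (x.S \ insert (x.τ q) (U.erase q)) ∪ {p, x.τ q} =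
      x.T ∪ (x.S \ U) ∪ {p, q} := by
    have h1 := x.τ_mem_S hqS
    ext l
    simp only [mem_union, mem_sdiff, mem_insert, mem_erase, mem_singleton]
    by_cases hl : l = q
    · subst hl
      have := x.mem_S.1 hqS
      simp [hqS, this.symm]
    by_cases hl' : l = x.τ q
    · subst hl'
      simp [h1, hqU]
    · simp [hl, hl']
  simp only [term]
  rw [e1, e2, posSign_τ hqS]
  ring

theorem sum_pointed_swap (w u : Finset (Fin n) → ℝ) (I : Fin n → Prop) (Q : Fin n → Fin n → Prop)
    [∀ a b, Decidable (Q a b)] :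
    ∑ t ∈ x.pointed I with Q t.2.1 t.1, x.term w u t =
      ∑ t ∈ x.pointed I with Q t.1 t.2.1, x.term w u t := by
  refine sum_bij (fun t _ => (t.2.1, t.1, t.2.2)) ?_ ?_ ?_ ?_
  · rintro ⟨p, q, U⟩ h
    rw [mem_filter, mem_pointed] at h ⊢
    exact ⟨⟨h.1.1.symm, h.1.2.2.1, h.1.2.1, h.1.2.2.2.2.1, h.1.2.2.2.1, h.1.2.2.2.2.2⟩, h.2⟩
  · rintro ⟨p, q, U⟩ _ ⟨p', q', U'⟩ _ h
    simp only [Prod.mk.injEq] at h ⊢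
    tauto
  · rintro ⟨p, q, U⟩ h
    rw [mem_filter, mem_pointed] at h
    refine ⟨(q, p, U), ?_, rfl⟩
    rw [mem_filter, mem_pointed]
    exact ⟨⟨h.1.1.symm, h.1.2.2.1, h.1.2.1, h.1.2.2.2.2.1, h.1.2.2.2.1, h.1.2.2.2.2.2⟩, h.2⟩
  · rintro ⟨p, q, U⟩ _
    exact (term_swap w u p q U).symm

/-- Moving a distinguished element to the other end of its arc changes the sign of the
contribution. -/
theorem sum_pointed_eq_zero (w u : Finset (Fin n) → ℝ) (I : Fin n → Prop) (P : Fin n → Prop)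
    [DecidablePred I] [DecidablePred P] :
    ∑ t ∈ x.pointed I with P t.1 ∧ I (x.τ t.2.1), x.term w u t = 0 := by
  refine sum_involution
    (fun t _ => (t.1, x.τ t.2.1, insert (x.τ t.2.1) (t.2.2.erase t.2.1))) ?_ ?_ ?_ ?_
  · rintro ⟨p, q, U⟩ h
    rw [mem_filter, mem_pointed] at h
    rw [term_flip w u h.1.2.2.2.2.2 h.1.2.2.2.1 h.1.2.2.2.2.1, add_neg_cancel]
  · rintro ⟨p, q, U⟩ h _ heq
    rw [mem_filter, mem_pointed] at h
    simp only [Prod.mk.injEq] at heq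
    exact x.mem_S.1 (h.1.2.2.2.2.2.1 h.1.2.2.2.2.1) heq.2.1
  · rintro ⟨p, q, U⟩ h
    rw [mem_filter, mem_pointed] at h ⊢
    obtain ⟨⟨h1, h2, h3, h4, h5, h6⟩, h7, h8⟩ := h
    have hqU : x.τ q ∉ U := fun h => ((h6.2 q (h6.1 h5)).1 h) h5
    refine ⟨⟨fun h => hqU (h ▸ h4), h2, h8, ?_, mem_insert_self _ _, h6.flip h5⟩, h7, ?_⟩
    · exact mem_insert_of_mem (mem_erase.2 ⟨h1, h4⟩)
    · change I (x.τ (x.τ q))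
      rwa [x.involutive]
  · rintro ⟨p, q, U⟩ h
    rw [mem_filter, mem_pointed] at h
    obtain ⟨⟨h1, h2, h3, h4, h5, h6⟩, h7, h8⟩ := h
    have hqU : x.τ q ∉ U := fun h => ((h6.2 q (h6.1 h5)).1 h) h5
    simp only [x.involutive, Prod.mk.injEq, true_and]
    rw [erase_insert (fun h => hqU (mem_of_mem_erase h)), insert_erase h5]

theorem sum_pointed_eq (w u : Finset (Fin n) → ℝ) (I : Fin n → Prop) [DecidablePred I] :
    ∑ t ∈ x.pointed I, x.term w u t =
      2 * ∑ t ∈ x.pointed I with (¬I (x.τ t.1) ∧ ¬I (x.τ t.2.1)) ∧ t.1 < t.2.1,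
        x.term w u t := by
  have h1 : ∑ t ∈ x.pointed I with I (x.τ t.1), x.term w u t = 0 := by
    have h := sum_pointed_swap (x := x) w u I (fun _ b => I (x.τ b))
    rw [h]
    simpa using sum_pointed_eq_zero (x := x) w u I (fun _ => True)
  have h2 := sum_pointed_eq_zero (x := x) w u I (fun p => ¬I (x.τ p))
  have h3 : ∑ t ∈ x.pointed I, x.term w u t =
      ∑ t ∈ x.pointed I with ¬I (x.τ t.1) ∧ ¬I (x.τ t.2.1), x.term w u t := by
    rw [← sum_filter_add_sum_filter_not (x.pointed I) (fun t => I (x.τ t.1)), h1, zero_add,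
      ← sum_filter_add_sum_filter_not _ (fun t : Fin n × Fin n × Finset (Fin n) => I (x.τ t.2.1)),
      filter_filter, filter_filter, h2, zero_add]
  have h4 := sum_pointed_swap (x := x) w u I (fun p q => (¬I (x.τ p) ∧ ¬I (x.τ q)) ∧ p < q)
  rw [h3, two_mul]
  nth_rewrite 2 [← h4]
  rw [← sum_filter_add_sum_filter_not _ (fun t : Fin n × Fin n × Finset (Fin n) => t.1 < t.2.1),
    filter_filter, filter_filter]
  congr 1
  refine sum_congr ?_ fun _ _ => rfl
  ext ⟨p, q, U⟩
  simp only [mem_filter, mem_pointed, not_lt]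
  constructor
  · rintro ⟨h, h', h''⟩
    exact ⟨h, h'.symm, lt_of_le_of_ne h'' h.1.symm⟩
  · rintro ⟨h, h', h''⟩
    exact ⟨h, h'.symm, h''.le⟩

end PartialMatching

open Classical in
/-- The products of Plücker coordinates of `M` in `⟨p q⟩ [p q]` are expanded into immanants. -/
theorem contraction_mul_contraction_eq_sum {l : ℕ} {M : Matrix (Fin (l + 2)) (Fin n) ℝ}
    {F : PartialMatching (l + 2) n → ℝ} (hF : IsTLFamily M F) (W : Matrix (Fin l) (Fin n) ℝ)
    (L : Matrix (Fin (l + 2 + 2)) (Fin n) ℝ) {p q : Fin n} (hpq : p ≠ q) :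
    contraction M W p q * contraction L M p q = ∑ x, (∑ U with p ∈ U ∧ q ∈ U ∧ x.IsTransversal U,
      x.term (plucker W) (plucker L) (p, q, U)) * F x := by
  set s : Finset (Fin n) → ℝ := fun A => ∏ a ∈ A, ordSign p a * ordSign q a with hs
  have hexp : ∀ A B : Finset (Fin n),
      plucker W A * (ordSign p q * s A * plucker M (insert p (insert q A))) *
        (plucker M B * (ordSign p q * s B * plucker L (insert p (insert q B)))) =
      ∑ x : PartialMatching (l + 2) n,
        if (p ∉ A ∧ q ∉ A) ∧ (p ∉ B ∧ q ∉ B) ∧ x.Compatible (insert p (insert q A)) B then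
          s A * s B * plucker W A * plucker L (insert p (insert q B)) * F x else 0 := by
    intro A B
    have hz : ∀ A : Finset (Fin n), ¬(p ∉ A ∧ q ∉ A) → s A = 0 := by
      intro A h
      rw [not_and_or, not_not, not_not] at h
      rcases h with h | h
      · exact prod_eq_zero h (by simp)
      · exact prod_eq_zero h (by simp)
    by_cases hA : p ∉ A ∧ q ∉ A
    · by_cases hB : p ∉ B ∧ q ∉ B
      · have hM : plucker M (insert p (insert q A)) * plucker M B =
            ∑ x : PartialMatching (l + 2) n with x.Compatible (insert p (insert q A)) B, F x := by
          by_cases hc : (insert p (insert q A)).card = l + 2 ∧ B.card = l + 2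
          · exact hF _ _ hc.1 hc.2
          · rw [filter_false_of_mem fun x _ hx => hc hx.card, sum_empty, mul_eq_zero]
            rw [not_and_or] at hc
            exact hc.imp plucker_eq_zero_of_card plucker_eq_zero_of_card
        have h1 := ordSign_mul_self hpq
        calc _ = (ordSign p q * ordSign p q) * (s A * s B * plucker W A *
              plucker L (insert p (insert q B))) *
              (plucker M (insert p (insert q A)) * plucker M B) := by ring
          _ = _ := by
            rw [h1, one_mul, hM, mul_sum, sum_filter]
            simp only [hA, hB, true_and, not_false_eq_true]
      · rw [hz B hB]
        simp [hB]
    · rw [hz A hA]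
      simp [hA]
  rw [contraction_eq_sum, contraction_eq_sum, sum_mul_sum]
  change ∑ A, ∑ B, plucker W A * (ordSign p q * s A * plucker M (insert p (insert q A))) *
        (plucker M B * (ordSign p q * s B * plucker L (insert p (insert q B)))) = _
  rw [sum_congr rfl fun A _ => sum_congr rfl fun B _ => hexp A B, ← sum_product', sum_comm]
  refine sum_congr rfl fun x _ => ?_
  rw [← sum_filter, ← sum_mul]
  congr 1
  symm
  refine sum_bij (fun U _ => (x.T ∪ (U.erase p).erase q, x.T ∪ (x.S \ U))) ?_ ?_ ?_ ?_
  · intro U hU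
    simp only [mem_filter, mem_univ, true_and] at hU
    obtain ⟨hp, hq, hU⟩ := hU
    have hpT : p ∉ x.T := fun h => disjoint_left.1 x.disjoint_T_S h (hU.1 hp)
    have hqT : q ∉ x.T := fun h => disjoint_left.1 x.disjoint_T_S h (hU.1 hq)
    have e : insert p (insert q (x.T ∪ (U.erase p).erase q)) = x.T ∪ U := by
      ext a
      simp only [mem_insert, mem_union, mem_erase]
      by_cases h1 : a = p
      · subst h1; simp [hp]
      by_cases h2 : a = q
      · subst h2; simp [hq]
      simp [h1, h2]
    simp only [mem_filter, mem_product, mem_univ, true_and]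
    rw [e, PartialMatching.compatible_union_iff x.disjoint_T_S hU.1]
    simp [hp, hq, hpT, hqT, hU]
  · intro U hU U' hU' h
    simp only [mem_filter, mem_univ, true_and] at hU hU'
    have h2 := (Prod.mk.injEq _ _ _ _ ▸ h).2
    have key : ∀ U : Finset (Fin n), U ⊆ x.S → ∀ a, a ∈ U ↔ a ∈ x.S ∧ a ∉ x.T ∪ (x.S \ U) := by
      intro U hU a
      have h1 := @hU a
      have h2 : a ∈ x.S → a ∉ x.T := fun h h' => disjoint_left.1 x.disjoint_T_S h' h
      simp only [mem_union, mem_sdiff]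
      tauto
    ext a
    rw [key U hU.2.2.1, key U' hU'.2.2.1, h2]
  · rintro ⟨A, B⟩ h
    simp only [mem_filter, mem_product, mem_univ, true_and] at h
    obtain ⟨⟨hpA, hqA⟩, ⟨hpB, hqB⟩, hc⟩ := h
    obtain ⟨c1, c2, c3⟩ := PartialMatching.compatible_iff.1 hc
    refine ⟨insert p (insert q A) \ B, ?_, ?_⟩
    · simp [hpB, hqB, c3]
    · rw [c1, c2, Prod.mk.injEq]
      constructor
      · ext a
        simp only [mem_union, mem_inter, mem_insert, mem_erase, mem_sdiff]
        by_cases h1 : a = p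
        · subst h1; simp [hpA, hpB]
        by_cases h2 : a = q
        · subst h2; simp [hqA, hqB]
        simp only [h1, h2, false_or, not_false_eq_true, true_and, ne_eq]
        tauto
      · ext a
        simp only [mem_union, mem_inter, mem_sdiff]
        tauto
  · intro U hU
    simp only [mem_filter, mem_univ, true_and] at hU
    obtain ⟨hp, hq, hU⟩ := hU
    have hpT : p ∉ x.T := fun h => disjoint_left.1 x.disjoint_T_S h (hU.1 hp)
    have hqT : q ∉ x.T := fun h => disjoint_left.1 x.disjoint_T_S h (hU.1 hq)
    have hTS := x.disjoint_T_S
    have e1 : insert p (insert q (x.T ∪ (x.S \ U))) = x.T ∪ (x.S \ U) ∪ {p, q} := by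
      ext a
      simp only [mem_insert, mem_union, mem_singleton]
      tauto
    have hd1 : Disjoint x.T ((U.erase p).erase q) :=
      hTS.mono_right (((erase_subset _ _).trans (erase_subset _ _)).trans hU.1)
    have hd2 : Disjoint ((U.erase p).erase q) (x.S \ U) :=
      disjoint_sdiff.mono_left ((erase_subset _ _).trans (erase_subset _ _))
    have e2 : (x.S.erase p).erase q = (U.erase p).erase q ∪ (x.S \ U) := by
      ext a
      have := @hU.1 a
      simp only [mem_erase, mem_union, mem_sdiff]
      by_cases h1 : a = p
      · subst h1; simp [hp]
      by_cases h2 : a = q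
      · subst h2; simp [hq]
      simp only [h1, h2, ne_eq, not_false_eq_true, true_and]
      tauto
    have e3 : s x.T * s x.T = 1 := by
      simp only [hs]
      rw [← prod_mul_distrib]
      refine prod_eq_one fun a ha => ?_
      have h1 : p ≠ a := by
        rintro rfl
        exact hpT ha
      have h2 : q ≠ a := by
        rintro rfl
        exact hqT ha
      rw [mul_mul_mul_comm, ordSign_mul_self h1, ordSign_mul_self h2, one_mul]
    have e4 : s (x.T ∪ (U.erase p).erase q) * s (x.T ∪ (x.S \ U)) =
        -(posSign x.S p * posSign x.S q) := by
      rw [← prod_ordSign_mul_ordSign (hU.1 hp) (hU.1 hq) hpq, e2, prod_union hd2]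
      simp only [hs]
      rw [prod_union hd1, prod_union (hTS.mono_right sdiff_subset)]
      simp only [hs] at e3
      linear_combination ((∏ a ∈ (U.erase p).erase q, ordSign p a * ordSign q a) *
        ∏ a ∈ x.S \ U, ordSign p a * ordSign q a) * e3
    simp only [PartialMatching.term]
    rw [e1, ← e4]

/-! ### Markings -/

namespace PartialMatching

variable {k : ℕ} {x : PartialMatching k n}

variable (x) in
open Classical in
/-- The marking of a transversal `U` with distinguished elements `p`, `q`. -/
noncomputable def markingOf (p q : Fin n) (U : Finset (Fin n)) (l : {l : Fin n // l ∈ x.S}) :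
    Mark :=
  if l.1 = p ∨ l.1 = q then Mark.J else if l.1 ∈ U then Mark.L else Mark.R

theorem markingOf_eq_J {p q : Fin n} {U : Finset (Fin n)} {l : {l : Fin n // l ∈ x.S}} :
    x.markingOf p q U l = Mark.J ↔ l.1 = p ∨ l.1 = q := by
  unfold markingOf
  split_ifs with h1 h2 <;> simp [h1]

theorem markingOf_eq_L {p q : Fin n} {U : Finset (Fin n)} {l : {l : Fin n // l ∈ x.S}} :
    x.markingOf p q U l = Mark.L ↔ (l.1 ≠ p ∧ l.1 ≠ q) ∧ l.1 ∈ U := by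
  unfold markingOf
  rw [← not_or]
  split_ifs with h1 h2 <;> simp [h1]
  · exact h2
  · exact h2

theorem markingOf_eq_R {p q : Fin n} {U : Finset (Fin n)} (hp : p ∈ U) (hq : q ∈ U)
    {l : {l : Fin n // l ∈ x.S}} : x.markingOf p q U l = Mark.R ↔ l.1 ∉ U := by
  unfold markingOf
  split_ifs with h1 h2
  · rcases h1 with h1 | h1 <;> simp [h1, hp, hq]
  · simp [h2]
  · simp [h2]

theorem mem_fiber {μ : {l : Fin n // l ∈ x.S} → Mark} {c : Mark} {l : Fin n} :
    l ∈ fiber x μ c ↔ ∃ h : l ∈ x.S, μ ⟨l, h⟩ = c := by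
  simp [fiber]

theorem isMarking_markingOf {i j : ℤ} {p q : Fin n} {U : Finset (Fin n)}
    (h : (p, q, U) ∈ x.pointed (InInterval i j)) (hp' : ¬InInterval i j (x.τ p))
    (hq' : ¬InInterval i j (x.τ q)) : IsMarking x i j (x.markingOf p q U) := by
  obtain ⟨hpq, hp, hq, hpU, hqU, hU⟩ := mem_pointed.1 h
  refine ⟨⟨p, hU.1 hpU⟩, ⟨q, hU.1 hqU⟩, fun e => hpq (congrArg Subtype.val e),
    ⟨markingOf_eq_J.2 (Or.inl rfl), hp, (markingOf_eq_R hpU hqU).2 ?_, hp'⟩,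
    ⟨markingOf_eq_J.2 (Or.inr rfl), hq, (markingOf_eq_R hpU hqU).2 ?_, hq'⟩, ?_⟩
  · exact fun h => ((hU.2 p (hU.1 hpU)).1 h) hpU
  · exact fun h => ((hU.2 q (hU.1 hqU)).1 h) hqU
  · intro l h1 h2 h3 h4
    have h1' : l.1 ≠ p := fun e => h1 (Subtype.ext e)
    have h2' : x.τ l.1 ≠ p := fun e => h2 (Subtype.ext (x.τ_eq_iff.1 e))
    have h3' : l.1 ≠ q := fun e => h3 (Subtype.ext e)
    have h4' : x.τ l.1 ≠ q := fun e => h4 (Subtype.ext (x.τ_eq_iff.1 e))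
    rw [markingOf_eq_L, markingOf_eq_L, markingOf_eq_R hpU hqU, markingOf_eq_R hpU hqU]
    change (_ ∧ x.τ l.1 ∉ U) ∨ (_ ∧ (x.τ l.1 ≠ p ∧ x.τ l.1 ≠ q) ∧ x.τ l.1 ∈ U)
    have := hU.2 l.1 l.2
    tauto

open Classical in
theorem exists_markingOf_eq {i j : ℤ} {μ : {l : Fin n // l ∈ x.S} → Mark}
    (hμ : IsMarking x i j μ) : ∃ p q U, (p, q, U) ∈ x.pointed (InInterval i j) ∧
      (¬InInterval i j (x.τ p) ∧ ¬InInterval i j (x.τ q)) ∧ p < q ∧ x.markingOf p q U = μ := by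
  have hmm : ∀ l, x.mate (x.mate l) = l := fun l => Subtype.ext (x.involutive l.1)
  obtain ⟨l₁, l₂, hne, ⟨a1, a2, a3, a4⟩, ⟨b1, b2, b3, b4⟩, hrest⟩ := hμ
  set U : Finset (Fin n) := x.S \ fiber x μ Mark.R with hUdef
  have hmemU : ∀ l : {l : Fin n // l ∈ x.S}, l.1 ∈ U ↔ μ l ≠ Mark.R := by
    intro l
    rw [hUdef, mem_sdiff, mem_fiber]
    exact ⟨fun h h' => h.2 ⟨l.2, h'⟩, fun h => ⟨l.2, fun ⟨_, h'⟩ => h h'⟩⟩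
  have hcases : ∀ l, (μ l = Mark.R ∧ μ (x.mate l) ≠ Mark.R) ∨
      (μ l ≠ Mark.R ∧ μ (x.mate l) = Mark.R) := by
    intro l
    by_cases h1 : l = l₁
    · subst h1; rw [a1, a3]; simp
    by_cases h2 : l = x.mate l₁
    · subst h2; rw [hmm, a1, a3]; simp
    by_cases h3 : l = l₂
    · subst h3; rw [b1, b3]; simp
    by_cases h4 : l = x.mate l₂
    · subst h4; rw [hmm, b1, b3]; simp
    rcases hrest l h1 h2 h3 h4 with ⟨h, h'⟩ | ⟨h, h'⟩ <;> rw [h, h'] <;> simp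
  have hJ : ∀ l, μ l = Mark.J ↔ l = l₁ ∨ l = l₂ := by
    intro l
    constructor
    · intro h
      by_contra hc
      push Not at hc
      by_cases h2 : l = x.mate l₁
      · subst h2; rw [a3] at h; cases h
      by_cases h4 : l = x.mate l₂
      · subst h4; rw [b3] at h; cases h
      rcases hrest l hc.1 h2 hc.2 h4 with ⟨h', _⟩ | ⟨h', _⟩ <;> rw [h'] at h <;> cases h
    · rintro (rfl | rfl)
      · exact a1
      · exact b1
  have hU : x.IsTransversal U := by
    refine ⟨sdiff_subset, fun l hl => ?_⟩
    rw [hmemU ⟨l, hl⟩, show x.τ l = (x.mate ⟨l, hl⟩).1 from rfl, hmemU]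
    have := hcases ⟨l, hl⟩
    tauto
  have h1U : l₁.1 ∈ U := (hmemU l₁).2 (by rw [a1]; simp)
  have h2U : l₂.1 ∈ U := (hmemU l₂).2 (by rw [b1]; simp)
  have hval : x.markingOf l₁.1 l₂.1 U = μ := by
    funext l
    have e1 : x.markingOf l₁.1 l₂.1 U l = Mark.J ↔ μ l = Mark.J := by
      rw [markingOf_eq_J, hJ, Subtype.ext_iff, Subtype.ext_iff]
    have e2 : x.markingOf l₁.1 l₂.1 U l = Mark.R ↔ μ l = Mark.R := by
      rw [markingOf_eq_R h1U h2U, hmemU, not_not]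
    cases h : x.markingOf l₁.1 l₂.1 U l <;> cases h' : μ l <;> simp_all
  have hne' : l₁.1 ≠ l₂.1 := fun e => hne (Subtype.ext e)
  rcases lt_or_gt_of_ne hne' with h | h
  · exact ⟨l₁, l₂, U, mem_pointed.2 ⟨hne', a2, b2, h1U, h2U, hU⟩, ⟨a4, b4⟩, h, hval⟩
  · refine ⟨l₂, l₁, U, mem_pointed.2 ⟨hne'.symm, b2, a2, h2U, h1U, hU⟩, ⟨b4, a4⟩, h, ?_⟩
    rw [← hval]
    funext l
    simp only [markingOf, or_comm]

open Classical in
/-- The terms of a coefficient are the contributions of the pointed transversals whose two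
distinguished arcs leave the interval. -/
theorem coeff_eq_sum_term {i j : ℤ} (hij : j - i ≤ n) (Lp : Matrix (Fin (k - 2)) (Fin n) ℝ)
    (Lat : Matrix (Fin (k + 2)) (Fin n) ℝ) :
    coeff i j x Lp Lat = ∑ t ∈ x.pointed (InInterval i j) with
      (¬InInterval i j (x.τ t.1) ∧ ¬InInterval i j (x.τ t.2.1)) ∧ t.1 < t.2.1,
        x.term (plucker Lp) (plucker Lat) t := by
  unfold coeff
  symm
  refine sum_bij (fun t _ => x.markingOf t.1 t.2.1 t.2.2) ?_ ?_ ?_ ?_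
  · rintro ⟨p, q, U⟩ h
    rw [mem_filter] at h ⊢
    exact ⟨mem_univ _, isMarking_markingOf h.1 h.2.1.1 h.2.1.2⟩
  · rintro ⟨p, q, U⟩ h ⟨p', q', U'⟩ h' heq
    rw [mem_filter, mem_pointed] at h h'
    obtain ⟨⟨hpq, hp, hq, hpU, hqU, hU⟩, _, hlt⟩ := h
    obtain ⟨⟨hpq', hp', hq', hpU', hqU', hU'⟩, _, hlt'⟩ := h'
    simp only at *
    have hJ : ∀ l ∈ x.S, (l = p ∨ l = q) ↔ (l = p' ∨ l = q') := by
      intro l hl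
      rw [← markingOf_eq_J (U := U) (l := ⟨l, hl⟩), heq, markingOf_eq_J]
    have hR : ∀ l ∈ x.S, l ∉ U ↔ l ∉ U' := by
      intro l hl
      rw [← markingOf_eq_R hpU hqU (l := ⟨l, hl⟩), heq, markingOf_eq_R hpU' hqU']
    have h1 := (hJ p (hU.1 hpU)).1 (Or.inl rfl)
    have h2 := (hJ q (hU.1 hqU)).1 (Or.inr rfl)
    have e : p = p' ∧ q = q' := by
      rcases h1 with rfl | rfl
      · rcases h2 with rfl | rfl
        · exact absurd rfl hpq
        · exact ⟨rfl, rfl⟩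
      · rcases h2 with rfl | rfl
        · exact absurd hlt hlt'.not_gt
        · exact absurd rfl hpq
    rw [Prod.mk.injEq, Prod.mk.injEq]
    refine ⟨e.1, e.2, ?_⟩
    ext l
    constructor
    · intro h
      by_contra h'
      exact (hR l (hU.1 h)).2 h' h
    · intro h
      by_contra h'
      exact (hR l (hU'.1 h)).1 h' h
  · intro μ hμ
    obtain ⟨p, q, U, h1, h2, h3, h4⟩ := exists_markingOf_eq (mem_filter.1 hμ).2
    exact ⟨(p, q, U), mem_filter.2 ⟨h1, h2, h3⟩, h4⟩
  · rintro ⟨p, q, U⟩ h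
    rw [mem_filter, mem_pointed] at h
    obtain ⟨⟨hpq, hp, hq, hpU, hqU, hU⟩, ⟨hp', hq'⟩, hlt⟩ := h
    simp only at *
    have fL : fiber x (x.markingOf p q U) Mark.L = (U.erase p).erase q := by
      ext l
      simp only [mem_fiber, markingOf_eq_L, mem_erase]
      exact ⟨fun ⟨_, h⟩ => ⟨h.1.2, h.1.1, h.2⟩, fun h => ⟨hU.1 h.2.2, ⟨h.2.1, h.1⟩, h.2.2⟩⟩
    have fR : fiber x (x.markingOf p q U) Mark.R = x.S \ U := by
      ext l
      simp only [mem_fiber, markingOf_eq_R hpU hqU, mem_sdiff, exists_prop]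
    have fJ : fiber x (x.markingOf p q U) Mark.J = {p, q} := by
      ext l
      simp only [mem_fiber, markingOf_eq_J, mem_insert, mem_singleton, exists_prop,
        and_iff_right_iff_imp]
      rintro (rfl | rfl)
      · exact hU.1 hpU
      · exact hU.1 hqU
    have hd : (-1 : ℝ) ^ dStat x i j (x.markingOf p q U) =
        -(posSign x.S p * posSign x.S q) := by
      rw [neg_posSign_mul_posSign (isCyclicInterval_inInterval hij) (hU.1 hpU) (hU.1 hqU) hpq hp hq
        hp' hq', dStat, fJ]
      congr 2
      refine filter_congr fun a _ => and_congr_right fun _ => and_congr_right fun _ => ?_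
      simp only [mem_insert, mem_singleton, exists_eq_or_imp, exists_eq_left]
      have : ∀ s, ¬Separates a (x.τ a) s (x.τ s) s (x.τ s) := by
        rintro s ⟨h1, _, h2 | h2, _⟩
        · exact absurd h1.1 h2.not_gt
        · exact absurd h1.2 h2.not_gt
      have h1 := this p
      have h2 := this q
      tauto
    rw [fL, fR, fJ, hd]
    rfl

end PartialMatching

open Classical in
/-- The double sum of products of contractions over an interval, expanded into immanants. -/
theorem sum_contraction_mul_contraction {l : ℕ} {M : Matrix (Fin (l + 2)) (Fin n) ℝ}
    {F : PartialMatching (l + 2) n → ℝ} (hF : IsTLFamily M F) (W : Matrix (Fin l) (Fin n) ℝ)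
    (L : Matrix (Fin (l + 2 + 2)) (Fin n) ℝ) {i j : ℤ} (hij : j - i ≤ n) :
    ∑ p : Fin n with InInterval i j p, ∑ q : Fin n with InInterval i j q,
      contraction M W p q * contraction L M p q =
        2 * ∑ x : PartialMatching (l + 2) n, coeff i j x W L * F x := by
  have h1 : ∀ p q : Fin n, contraction M W p q * contraction L M p q =
      ∑ x, (∑ U with p ≠ q ∧ p ∈ U ∧ q ∈ U ∧ x.IsTransversal U,
        x.term (plucker W) (plucker L) (p, q, U)) * F x := by
    intro p q
    by_cases hpq : p = q
    · subst hpq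
      rw [contraction_self, zero_mul]
      symm
      refine sum_eq_zero fun x _ => ?_
      rw [filter_false_of_mem fun U _ h => h.1 rfl, sum_empty, zero_mul]
    · rw [contraction_mul_contraction_eq_sum hF W L hpq]
      simp only [ne_eq, hpq, not_false_eq_true, true_and]
  simp only [h1]
  rw [sum_congr rfl fun p _ => sum_comm, sum_comm, mul_sum]
  refine sum_congr rfl fun x _ => ?_
  rw [PartialMatching.coeff_eq_sum_term hij, ← mul_assoc]
  have h2 := PartialMatching.sum_pointed_eq (x := x) (plucker W) (plucker L) (InInterval i j)
  refine Eq.trans ?_ (congrArg (· * F x) h2)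
  simp only [← sum_mul]
  congr 1
  rw [PartialMatching.pointed]
  simp only [sum_filter, Fintype.sum_prod_type]
  refine sum_congr rfl fun p _ => ?_
  by_cases hp : InInterval i j p
  · rw [if_pos hp]
    refine sum_congr rfl fun q _ => ?_
    by_cases hq : InInterval i j q
    · rw [if_pos hq]
      refine sum_congr rfl fun U _ => ?_
      simp only [hp, hq, true_and]
    · rw [if_neg hq]
      symm
      refine sum_eq_zero fun U _ => ?_
      rw [if_neg]
      exact fun h => hq h.2.2.1
  · rw [if_neg hp]
    symm
    refine sum_eq_zero fun q _ => sum_eq_zero fun U _ => ?_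
    rw [if_neg]
    exact fun h => hp h.2.1

/-! ### Signs of the common factors -/

/-- A positive consecutive bracket fixes the sign of the factor between minors and contractions:
for cyclically adjacent columns all terms of the contraction have the sign of `s`. -/
theorem mul_pos_of_bracket_pos {k : ℕ} (hn : 2 ≤ n) {M : Matrix (Fin (r + 2)) (Fin n) ℝ}
    {W : Matrix (Fin r) (Fin n) ℝ} (hk : (-1 : ℝ) ^ k = (-1) ^ r) {N : Matrix (Fin 2) (Fin n) ℝ}
    {c s : ℝ} (hc : ∀ a b, minor2 N a b = c * contraction M W a b) (hs0 : s ≠ 0) (hc0 : c ≠ 0)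
    (hs : ∀ A B, 0 ≤ s * (plucker W A * plucker M B)) (hn0 : 0 < n)
    (hp : ∃ p : ℤ, 0 < bracket k hn0 N p (p + 1)) : 0 < s * c := by
  have key : ∀ d : ℝ, 0 < c * d → 0 ≤ s * d → 0 < s * c := by
    intro d h1 h2
    have h3 : 0 < c * d * (c * d) := mul_pos h1 h1
    refine lt_of_le_of_ne ?_ (mul_ne_zero hs0 hc0).symm
    have hd : 0 < d * d := mul_self_pos.2 (right_ne_zero_of_mul h1.ne')
    have h4 : 0 ≤ (s * c) * (d * d) := by
      have := mul_nonneg h2 h1.le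
      linarith
    exact nonneg_of_mul_nonneg_left h4 hd
  obtain ⟨p, hp⟩ := hp
  rcases bracket_succ_eq k hn0 N p with ⟨a, b, hab, h⟩ | ⟨a, b, ha, hb, h⟩
  · rw [h, hc] at hp
    have h1 := mul_contraction_nonneg (σ := 1) hs (p := a) (q := b) (by rw [Fin.lt_def]; omega) (by
      intro A _ haA hbA
      refine prod_eq_one fun e he => ?_
      have h1 : e ≠ a := fun h => haA (h ▸ he)
      have h2 : e ≠ b := fun h => hbA (h ▸ he)
      rw [ne_eq, Fin.ext_iff] at h1 h2
      refine ordSign_mul_ordSign_of_not_between (by rw [Fin.lt_def]; omega) ?_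
      rw [Fin.lt_def, Fin.lt_def]
      omega) (by norm_num)
    rw [one_mul] at h1
    exact key _ hp h1
  · rw [h, hc, hk] at hp
    have hab : a < b := by rw [Fin.lt_def]; omega
    have h1 := mul_contraction_nonneg (σ := (-1) ^ r) hs hab (by
      intro A hA haA hbA
      rw [← hA, ← prod_const]
      refine prod_congr rfl fun e he => ?_
      have h1 : e ≠ a := fun h => haA (h ▸ he)
      have h2 : e ≠ b := fun h => hbA (h ▸ he)
      rw [ne_eq, Fin.ext_iff] at h1 h2
      have := e.2
      refine ordSign_mul_ordSign_of_between ?_ ?_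
      · rw [Fin.lt_def]; omega
      · rw [Fin.lt_def]; omega) (by rw [← mul_pow]; norm_num)
    refine key _ ?_ h1
    linarith

/-- The orthogonal complement of an `alt`-positive subspace is positive. -/
theorem plucker_perp_of_alt_pos {l m : ℕ} (hn : l + m = n) {N : Matrix (Fin m) (Fin n) ℝ}
    (hN : IsTotallyPos (alt N)) {W : Matrix (Fin l) (Fin n) ℝ}
    (hW : Represents W (perp (rowSpan N))) :
    (∀ A B, 0 ≤ plucker W A * plucker W B) ∧
      ∀ A : Finset (Fin n), A.card = l → plucker W A ≠ 0 := by
  have hNi : LinearIndependent ℝ N.row := by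
    rw [Fintype.linearIndependent_iff]
    intro g hg
    refine Fintype.linearIndependent_iff.1 hN.1.1 g ?_
    funext a
    have h := congrFun hg a
    simp only [Finset.sum_apply, Pi.smul_apply, Matrix.row, smul_eq_mul, Pi.zero_apply] at h ⊢
    have e : ∀ s, g s * alt N s a = (-1) ^ (a : ℕ) * (g s * N s a) := by
      intro s
      change g s * ((-1) ^ (a : ℕ) * N s a) = _
      ring
    rw [sum_congr rfl fun s _ => e s, ← mul_sum, h, mul_zero]
  have hNW : N * Wᵀ = 0 := by
    ext i j
    have hj : W j ∈ perp (rowSpan N) := by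
      rw [← hW.2]
      exact Submodule.subset_span ⟨j, rfl⟩
    have := mem_perp_rowSpan.1 hj i
    rw [dotProduct_comm] at this
    exact this
  obtain ⟨c, hc, h⟩ := exists_plucker_eq_mul_plucker_alt_compl hn hNi hW.1 hNW
  refine ⟨fun A B => ?_, fun A hA => ?_⟩
  · by_cases hA : A.card = l
    · by_cases hB : B.card = l
      · rw [h A hA, h B hB]
        have := mul_nonneg (mul_self_nonneg c) (hN.1.plucker_mul_nonneg Aᶜ Bᶜ)
        linarith
      · rw [plucker_eq_zero_of_card hB, mul_zero]
    · rw [plucker_eq_zero_of_card hA, zero_mul]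
  · rw [h A hA]
    refine mul_ne_zero hc (hN.2 _ ?_)
    rw [card_compl, hA, Fintype.card_fin]
    omega

theorem mandelstam_eq_mul_sum {l : ℕ} (k : ℕ) {M : Matrix (Fin (l + 2)) (Fin n) ℝ}
    {F : PartialMatching (l + 2) n → ℝ} (hF : IsTLFamily M F) {W : Matrix (Fin l) (Fin n) ℝ}
    {L : Matrix (Fin (l + 2 + 2)) (Fin n) ℝ} {N N' : Matrix (Fin 2) (Fin n) ℝ} {c c' : ℝ}
    (hN : ∀ a b, minor2 N a b = c * contraction M W a b)
    (hN' : ∀ a b, minor2 N' a b = c' * contraction L M a b) (hn : 0 < n) {i j : ℤ}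
    (hij : j - i ≤ n) :
    mandelstam k hn N N' i j =
      (c * c') * ∑ x : PartialMatching (l + 2) n, coeff i j x W L * F x := by
  classical
  have h1 := two_mul_mandelstam k hn N N' hij
  have h2 := sum_contraction_mul_contraction hF W L hij
  have e : ∀ a b, minor2 N a b * minor2 N' a b =
      (c * c') * (contraction M W a b * contraction L M a b) := by
    intro a b
    rw [hN, hN']
    ring
  simp only [e, ← mul_sum] at h1
  rw [h2] at h1
  linarith

end TLMandelstam

/-- Here `C`, `La`, `Lat` represent `C`, `Λ`, `Λ̃`, and `Lp` represents `Λ^⊥`. -/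
theorem theorem5p1 (k n : ℕ) (hk : 2 ≤ k) (hkn : k + 2 ≤ n)
    (C : Matrix (Fin k) (Fin n) ℝ) (hC : TLMandelstam.IsTotallyNonneg C)
    (La : Matrix (Fin (n - k + 2)) (Fin n) ℝ)
    (hLa : TLMandelstam.IsTotallyPos (TLMandelstam.alt La))
    (Lat : Matrix (Fin (k + 2)) (Fin n) ℝ) (hLat : TLMandelstam.IsTotallyPos Lat)
    (Lp : Matrix (Fin (k - 2)) (Fin n) ℝ)
    (hLp : TLMandelstam.Represents Lp (TLMandelstam.perp (TLMandelstam.rowSpan La))) :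
    -- the Temperley-Lieb immanants of `C` are well defined
    (∃! F : TLMandelstam.PartialMatching k n → ℝ, TLMandelstam.IsTLFamily C F) ∧
    -- the expansion holds exactly for suitable matrices representing the image of `C`
    (∃ la lat : Matrix (Fin 2) (Fin n) ℝ,
      TLMandelstam.Represents la (TLMandelstam.momentumMap (TLMandelstam.rowSpan La)
        (TLMandelstam.rowSpan Lat) (TLMandelstam.rowSpan C)).1 ∧
      TLMandelstam.Represents lat (TLMandelstam.momentumMap (TLMandelstam.rowSpan La)
        (TLMandelstam.rowSpan Lat) (TLMandelstam.rowSpan C)).2 ∧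
      ∀ i j : ℤ, i + 2 ≤ j → j ≤ i + n - 2 →
        TLMandelstam.mandelstam k (show 0 < n by omega) la lat i j =
          ∑ x : TLMandelstam.PartialMatching k n,
            TLMandelstam.coeff i j x Lp Lat * TLMandelstam.tlImmanant C x) ∧
    -- and up to one common nonzero factor, of known sign, for all matrices representing it
    (∀ la lat : Matrix (Fin 2) (Fin n) ℝ,
      TLMandelstam.Represents la (TLMandelstam.momentumMap (TLMandelstam.rowSpan La)
        (TLMandelstam.rowSpan Lat) (TLMandelstam.rowSpan C)).1 →
      TLMandelstam.Represents lat (TLMandelstam.momentumMap (TLMandelstam.rowSpan La)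
        (TLMandelstam.rowSpan Lat) (TLMandelstam.rowSpan C)).2 →
      ∃ κ : ℝ, κ ≠ 0 ∧
        (∀ i j : ℤ, i + 2 ≤ j → j ≤ i + n - 2 →
          TLMandelstam.mandelstam k (show 0 < n by omega) la lat i j =
            κ * ∑ x : TLMandelstam.PartialMatching k n,
              TLMandelstam.coeff i j x Lp Lat * TLMandelstam.tlImmanant C x) ∧
        ((∀ I : Finset (Fin n), 0 ≤ TLMandelstam.plucker Lp I) →
          (∀ I : Finset (Fin n), 0 ≤ TLMandelstam.plucker Lat I) →
          (∃ p : ℤ, 0 < TLMandelstam.bracket k (show 0 < n by omega) la p (p + 1)) →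
          (∃ p : ℤ, 0 < TLMandelstam.bracket k (show 0 < n by omega) lat p (p + 1)) →
          0 < κ)) := by
  obtain ⟨l, rfl⟩ : ∃ l, k = l + 2 := ⟨k - 2, by omega⟩
  have hTL := TLMandelstam.existsUnique_isTLFamily C
  have hF : TLMandelstam.IsTLFamily C (TLMandelstam.tlImmanant C) :=
    Classical.epsilon_spec hTL.exists
  have hp := TLMandelstam.plucker_perp_of_alt_pos (show l + (n - (l + 2) + 2) = n by omega) hLa hLp
  obtain ⟨p, q, hpq⟩ := TLMandelstam.exists_contraction_ne_zero_of_pos hC hp.1 hp.2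
  obtain ⟨p', q', hpq'⟩ := TLMandelstam.exists_contraction_ne_zero_of_pos' hC hLat hkn
  have hLaLp : TLMandelstam.rowSpan La = TLMandelstam.perp (TLMandelstam.rowSpan Lp) := by
    rw [hLp.2, TLMandelstam.perp_perp]
  have e1 : (TLMandelstam.momentumMap (TLMandelstam.rowSpan La) (TLMandelstam.rowSpan Lat)
      (TLMandelstam.rowSpan C)).1 =
      TLMandelstam.rowSpan C ⊓ TLMandelstam.perp (TLMandelstam.rowSpan Lp) := by
    rw [← hLaLp]
    rfl
  have e2 : (TLMandelstam.momentumMap (TLMandelstam.rowSpan La) (TLMandelstam.rowSpan Lat)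
      (TLMandelstam.rowSpan C)).2 =
      TLMandelstam.rowSpan Lat ⊓ TLMandelstam.perp (TLMandelstam.rowSpan C) := inf_comm _ _
  rw [e1, e2]
  refine ⟨hTL, ?_, ?_⟩
  · obtain ⟨la, hla, hla'⟩ := TLMandelstam.exists_represents_minor2_eq hpq
    obtain ⟨lat, hlat, hlat'⟩ := TLMandelstam.exists_represents_minor2_eq hpq'
    refine ⟨la, lat, hla, hlat, fun i j _ hij => ?_⟩
    rw [TLMandelstam.mandelstam_eq_mul_sum (l + 2) hF (c := 1) (c' := 1)
      (fun a b => by rw [hla', one_mul]) (fun a b => by rw [hlat', one_mul]) _ (by linarith),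
      one_mul, one_mul]
  · intro la lat hla hlat
    obtain ⟨c, hc, hla'⟩ := TLMandelstam.exists_minor2_eq_mul_contraction hpq hla
    obtain ⟨c', hc', hlat'⟩ := TLMandelstam.exists_minor2_eq_mul_contraction hpq' hlat
    refine ⟨c * c', mul_ne_zero hc hc', fun i j _ hij =>
      TLMandelstam.mandelstam_eq_mul_sum (l + 2) hF hla' hlat' _ (by linarith), ?_⟩
    intro hLp0 hLat0 hb hb'
    -- both factors have the sign of `s`, the common sign of the maximal minors of `C`
    obtain ⟨I, hI⟩ := TLMandelstam.exists_plucker_ne_zero hC.1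
    set s := TLMandelstam.plucker C I with hs
    have h1 := TLMandelstam.mul_pos_of_bracket_pos (s := s) (by omega) (by rw [pow_add]; norm_num)
      hla' hI hc (fun A B => by
        have := mul_nonneg (hLp0 A) (hC.plucker_mul_nonneg I B)
        linarith) _ hb
    have h2 := TLMandelstam.mul_pos_of_bracket_pos (s := s) (by omega) rfl
      hlat' hI hc' (fun A B => by
        have := mul_nonneg (hLat0 B) (hC.plucker_mul_nonneg I A)
        linarith) _ hb'
    have h3 : 0 < (s * s) * (c * c') := by
      have := mul_pos h1 h2
      linarith
    exact (mul_pos_iff_of_pos_left (mul_self_pos.2 hI)).1 h3
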